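/- **Market model.** Let $(\Omega,\mathcal F,(\mathcal F_t)_{t\ge0},\mathbb Q)$ be a filtered probability space with independent standard Wiener processes $\mathcal B_1,\mathcal B_2$ relative to $(\mathcal F_t)$ (adapted, with increments after $s$ jointly independent of $\mathcal F_s$). Let $\kappa\neq0$, $\theta\in\mathbb R$, $\sigma_r,\sigma_S>0$, $\rho\in[-1,1]$, and let $r$ and $S>0$ be continuous adapted processes, with constant initial values $r(0)$ and $S(0)$, such that $$dr(t)=\kappa(\theta-r(t))\,dt+\sigma_r\,d\mathcal B_1(t),\qquad \frac{dS(t)}{S(t)}=r(t)\,dt+\sigma_S\bigl(\rho\,d\mathcal B_1(t)+\sqrt{1-\rho^2}\,d\mathcal B_2(t)\bigr).$$ **Contract.** Let $N\ge1$, $0=t_0<t_1<\dots<t_N=T$, let $W(0)=A(0)\ge0$ be a constant premium, $\alpha\in\mathbb R$ the fee rate and $\beta\in[0,1]$ the penalty rate. The withdrawals $\pi_n$ ($0\le n<N$; $\pi_0=0$ if nothing is withdrawn at inception) are $\mathcal F_{t_n}$-measurable with $0\le\pi_n\le A(t_n)$ a.s., and $$W(t_{n+1})=\max(W(t_n)-\pi_n,0)\,\frac{S(t_{n+1})}{S(t_n)}\,e^{-\alpha(t_{n+1}-t_n)},\qquad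 A(t_{n+1})=A(t_n)-\pi_n .$$ With $G_N=W(0)(t_N-t_{N-1})/T$ put $C_N(x)=x$ for $0\le x\le G_N$ and $C_N(x)=G_N+(1-\beta)(x-G_N)$ for $x>G_N$. The final payoff is $\max(W(t_N),C_N(A(t_N)))$. Let $\ell\in\mathbb R$ and $$V:=\mathbb E\Bigl[e^{-\ell\int_{t_{N-1}}^{t_N}r(\tau)d\tau}\max\bigl(W(t_N),C_N(A(t_N))\bigr)\Bigm|\mathcal F_{t_{N-1}}\Bigr].$$ **Notation.** Let $\Delta=t_N-t_{N-1}$ and $$a=\exp\Bigl(-\ell\,\tfrac{1-e^{-\kappa\Delta}}{\kappa}\,r(t_{N-1})\Bigr),\quad b=\max(W(t_{N-1})-\pi_{N-1},0)\,e^{-\alpha\Delta}\exp\Bigl(\tfrac{1-e^{-\kappa\Delta}}{\kappa}\,r(t_{N-1})\Bigr),\quad c=C_N(A(t_N)),$$ $$Y=\int_{t_{N-1}}^{t_N}\bigl(r(\tau)-e^{-\kappa(\tau-t_{N-1})}r(t_{N-1})\bigr)d\tau,\qquad E=-\tfrac12\sigma_S^2\Delta+\sigma_S\int_{t_{N-1}}^{t_N}\bigl(\rho\,d\mathcal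 B_1+\sqrt{1-\rho^2}\,d\mathcal B_2\bigr),$$ $$\mu_Y=\theta\Bigl(\Delta-\tfrac{1-e^{-\kappa\Delta}}{\kappa}\Bigr),\qquad \varsigma_Y=\sqrt{\tfrac{\sigma_r^2}{\kappa^2}\Bigl[\Delta-\tfrac2\kappa(1-e^{-\kappa\Delta})+\tfrac1{2\kappa}(1-e^{-2\kappa\Delta})\Bigr]},$$ $$\mu_E=-\tfrac12\sigma_S^2\Delta,\qquad \varsigma_E=\sqrt{\sigma_S^2\Delta},\qquad \rho_{YE}=\frac{\rho\,\sigma_r\sigma_S}{\kappa\,\varsigma_Y\varsigma_E}\Bigl[\Delta-\tfrac1\kappa(1-e^{-\kappa\Delta})\Bigr].$$ **Statement.** The discounted payoff is integrable, and almost surely $a>0$, $b\ge0$, $c\ge0$ and $$V=a\,\mathbb E\bigl[e^{-\ell Y}\max(b\,e^{Y+E},c)\bigr],$$ where in the expectation on the right (and in the one below) $b$ and $c$ are held fixed at their realised values. Moreover, almost surely: 1. If $b=0$, then $V=ac\,\exp\bigl(-\ell\mu_Y+\ell^2\varsigma_Y^2/2\bigr)$. 2. If $c=0$, then $V=ab\,\exp\bigl((1-\ell)\mu_Y+\mu_E+\tfrac12[(1-\ell)^2\varsigma_Y^2+\varsigma_E^2+2(1-\ell)\rho_{YE}\varsigma_Y\varsigma_E]\bigr)$.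 3. If $b>0$ and $c>0$, put $X_1=\log b+(1-\ell)Y+E$, $X_2=\log c-\ell Y$, $m_1=\log b+(1-\ell)\mu_Y+\mu_E$, $m_2=\log c-\ell\mu_Y$, $\sigma_1=\sqrt{(1-\ell)^2\varsigma_Y^2+\varsigma_E^2+2(1-\ell)\rho_{YE}\varsigma_Y\varsigma_E}$, $\sigma_2=\ell\varsigma_Y$ and $\rho_{12}\sigma_1=-(1-\ell)\varsigma_Y-\rho_{YE}\varsigma_E$ (with $\rho_{12}:=0$ if $\sigma_1=0$). Then $$V=a\,\mathbb E\bigl[e^{\max(X_1,X_2)}\bigr]=a\,e^{m_1+\sigma_1^2/2}\,\Phi\!\left(\frac{m_1-m_2+\sigma_1^2-\rho_{12}\sigma_1\sigma_2}{\sqrt{\sigma_1^2+\sigma_2^2-2\rho_{12}\sigma_1\sigma_2}}\right)+a\,e^{m_2+\sigma_2^2/2}\,\Phi\!\left(\frac{m_2-m_1+\sigma_2^2-\rho_{12}\sigma_1\sigma_2}{\sqrt{\sigma_1^2+\sigma_2^2-2\rho_{12}\sigma_1\sigma_2}}\right),$$ where $\Phi$ is the standard normal distribution function. -/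

import Mathlib

open MeasureTheory ProbabilityTheory Filter Topology
open scoped NNReal

noncomputable section

/-! ### The market model -/

/-- Constants of the market model: mean-reversion speed, mean-reversion level and volatility of the
short rate, volatility of the asset, and correlation. -/
structure MarketParams where
  κ : ℝ
  θ : ℝ
  σr : ℝ
  σS : ℝ
  ρ : ℝ

/-- `B₁`, `B₂` are independent standard Wiener processes relative to the filtration `𝓕`: both are
adapted, and the pair of increments after time `s` is independent of `𝓕 s`. -/
structure IsWienerPair {Ω : Type*} {mΩ : MeasurableSpace Ω} (μ : Measure Ω)
    (𝓕 : Filtration ℝ≥0 mΩ) (B₁ B₂ : ℝ≥0 → Ω → ℝ) : Prop where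
  brownian₁ : IsBrownianReal B₁ μ
  brownian₂ : IsBrownianReal B₂ μ
  indep : IndepFun (fun ω t => B₁ t ω) (fun ω t => B₂ t ω) μ
  adapted₁ : Adapted 𝓕 B₁
  adapted₂ : Adapted 𝓕 B₂
  indep_past : ∀ s t : ℝ≥0, s ≤ t →
    Indep (MeasurableSpace.comap
      (fun ω => (B₁ t ω - B₁ s ω, B₂ t ω - B₂ s ω)) inferInstance) (𝓕 s) μ

/-- The time integral `∫_s^t r(u) du` along the path `ω`. -/
def timeIntegral {Ω : Type*} (r : ℝ≥0 → Ω → ℝ) (s t : ℝ≥0) (ω : Ω) : ℝ :=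
  ∫ u in (s : ℝ)..(t : ℝ), r u.toNNReal ω

/-- The points `τ n 0 ≤ τ n 1 ≤ … ≤ τ n (m n)` form a sequence (indexed by `n`) of partitions of
`[0, t]` whose mesh tends to zero. -/
structure IsPartitionSeq (t : ℝ≥0) (m : ℕ → ℕ) (τ : ℕ → ℕ → ℝ≥0) : Prop where
  mono : ∀ n, Monotone (τ n)
  left : ∀ n, τ n 0 = 0
  right : ∀ n, τ n (m n) = t
  mesh : ∀ ε : ℝ, 0 < ε → ∀ᶠ n in atTop, ∀ k < m n, (τ n (k + 1) : ℝ) - τ n k < ε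

/-- `J` is the Itô integral process `J t = ∫_0^t X dZ` of the continuous integrand `X` with respect
to the continuous integrator `Z`: for every `t`, the left-endpoint sums converge in probability to
`J t` along every sequence of partitions of `[0, t]` with mesh tending to zero. -/
def IsItoIntegral {Ω : Type*} {mΩ : MeasurableSpace Ω} (μ : Measure Ω)
    (X Z J : ℝ≥0 → Ω → ℝ) : Prop :=
  ∀ (t : ℝ≥0) (m : ℕ → ℕ) (τ : ℕ → ℕ → ℝ≥0), IsPartitionSeq t m τ →
    TendstoInMeasure μ
      (fun n ω => ∑ k ∈ Finset.range (m n), X (τ n k) ω * (Z (τ n (k + 1)) ω - Z (τ n k) ω))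
      atTop (J t)

/-- The driving Wiener process of the asset, `ρ B₁ + √(1 - ρ²) B₂`. -/
def assetNoise {Ω : Type*} (p : MarketParams) (B₁ B₂ : ℝ≥0 → Ω → ℝ) (t : ℝ≥0) (ω : Ω) : ℝ :=
  p.ρ * B₁ t ω + √(1 - p.ρ ^ 2) * B₂ t ω

/-- The short rate `r` solves `dr = κ (θ - r) dt + σr dB₁`, `r(0) = r₀`, and the asset price `S > 0`
solves `dS / S = r dt + σS (ρ dB₁ + √(1 - ρ²) dB₂)`, `S(0) = S₀`. -/
structure IsMarketModel {Ω : Type*} {mΩ : MeasurableSpace Ω} (μ : Measure Ω)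
    (𝓕 : Filtration ℝ≥0 mΩ) (p : MarketParams) (r₀ S₀ : ℝ)
    (B₁ B₂ r S : ℝ≥0 → Ω → ℝ) : Prop where
  wiener : IsWienerPair μ 𝓕 B₁ B₂
  adapted_r : Adapted 𝓕 r
  adapted_S : Adapted 𝓕 S
  continuous_r : ∀ ω, Continuous (fun t => r t ω)
  continuous_S : ∀ ω, Continuous (fun t => S t ω)
  pos_S : ∀ t ω, 0 < S t ω
  init_S : ∀ᵐ ω ∂μ, S 0 ω = S₀
  sde_r : ∀ᵐ ω ∂μ, ∀ t : ℝ≥0,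
    r t ω = r₀ + timeIntegral (fun u ω => p.κ * (p.θ - r u ω)) 0 t ω + p.σr * B₁ t ω
  sde_S : IsItoIntegral μ (fun t ω => (S t ω)⁻¹) S
    (fun t ω => timeIntegral r 0 t ω + p.σS * assetNoise p B₁ B₂ t ω)

/-! ### The contract -/

/-- Guarantee account: `A(t_0) = W₀`, `A(t_{n+1}) = A(t_n) - π_n`. -/
def guaranteeAccount {Ω : Type*} (W₀ : ℝ) (π : ℕ → Ω → ℝ) : ℕ → Ω → ℝ
  | 0 => fun _ => W₀
  | n + 1 => fun ω => guaranteeAccount W₀ π n ω - π n ω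

/-- Wealth account before the withdrawal at `t_n`: `W(t_0) = W₀` and
`W(t_{n+1}) = max(W(t_n) - π_n, 0) · S(t_{n+1}) / S(t_n) · exp(-α (t_{n+1} - t_n))`. -/
def wealthAccount {Ω : Type*} (W₀ α : ℝ) (t : ℕ → ℝ≥0) (S : ℝ≥0 → Ω → ℝ) (π : ℕ → Ω → ℝ) :
    ℕ → Ω → ℝ
  | 0 => fun _ => W₀
  | n + 1 => fun ω => max (wealthAccount W₀ α t S π n ω - π n ω) 0 *
      (S (t (n + 1)) ω / S (t n) ω) * Real.exp (-α * ((t (n + 1) : ℝ) - t n))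

/-- Cashflow from withdrawing `x ≥ 0` when the contractual amount is `G` and the penalty rate on
the excess is `β`. -/
def cashflow (β G x : ℝ) : ℝ := if x ≤ G then x else G + (1 - β) * (x - G)

/-- Contractual withdrawal amount `G_N = W₀ (t_N - t_{N-1}) / T` at the maturity `T = t_N`. -/
def contractualFinal (W₀ : ℝ) (t : ℕ → ℝ≥0) (N : ℕ) : ℝ :=
  W₀ * ((t N : ℝ) - t (N - 1)) / t N

/-- An admissible withdrawal strategy: `π_n` is known at `t_n` and `0 ≤ π_n ≤ A(t_n)`, for all
withdrawal dates before maturity. -/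
def IsAdmissible {Ω : Type*} {mΩ : MeasurableSpace Ω} (μ : Measure Ω) (𝓕 : Filtration ℝ≥0 mΩ)
    (W₀ : ℝ) (t : ℕ → ℝ≥0) (N : ℕ) (π : ℕ → Ω → ℝ) : Prop :=
  ∀ n < N, Measurable[𝓕 (t n)] (π n) ∧
    ∀ᵐ ω ∂μ, 0 ≤ π n ω ∧ π n ω ≤ guaranteeAccount W₀ π n ω

/-- `c = C_N(A(t_N))`, the guarantee account at maturity net of the penalty. -/
def finalGuarantee {Ω : Type*} (W₀ β : ℝ) (t : ℕ → ℝ≥0) (N : ℕ) (π : ℕ → Ω → ℝ) (ω : Ω) : ℝ :=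
  cashflow β (contractualFinal W₀ t N) (guaranteeAccount W₀ π N ω)

/-- The final payoff `max(W(t_N), C_N(A(t_N)))` discounted over the last period with
`exp(-ℓ ∫_{t_{N-1}}^{t_N} r)`. -/
def discountedPayoff {Ω : Type*} (W₀ α β ℓ : ℝ) (t : ℕ → ℝ≥0) (N : ℕ) (r S : ℝ≥0 → Ω → ℝ)
    (π : ℕ → Ω → ℝ) (ω : Ω) : ℝ :=
  Real.exp (-ℓ * timeIntegral r (t (N - 1)) (t N) ω) *
    max (wealthAccount W₀ α t S π N ω) (finalGuarantee W₀ β t N π ω)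

/-! ### The last period -/

/-- `(1 - exp(-κ Δ)) / κ = ∫_0^Δ exp(-κ u) du`. -/
def rateLoading (p : MarketParams) (Δ : ℝ) : ℝ := (1 - Real.exp (-p.κ * Δ)) / p.κ

/-- `Y = ∫_s^t (r(u) - exp(-κ (u - s)) r(s)) du`. -/
def noiseY {Ω : Type*} (p : MarketParams) (r : ℝ≥0 → Ω → ℝ) (s t : ℝ≥0) (ω : Ω) : ℝ :=
  timeIntegral (fun u ω => r u ω - Real.exp (-p.κ * ((u : ℝ) - s)) * r s ω) s t ω

/-- `E = -σS² (t - s) / 2 + ∫_s^t σS (ρ dB₁ + √(1 - ρ²) dB₂)`. -/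
def noiseE {Ω : Type*} (p : MarketParams) (B₁ B₂ : ℝ≥0 → Ω → ℝ) (s t : ℝ≥0) (ω : Ω) : ℝ :=
  -(1 / 2) * p.σS ^ 2 * ((t : ℝ) - s) +
    p.σS * (assetNoise p B₁ B₂ t ω - assetNoise p B₁ B₂ s ω)

/-- The factor `a = exp(-ℓ r(s) (1 - exp(-κ Δ)) / κ)`, with `s = t_{N-1}`, `Δ = t_N - t_{N-1}`. -/
def coeffA {Ω : Type*} (p : MarketParams) (ℓ : ℝ) (t : ℕ → ℝ≥0) (N : ℕ) (r : ℝ≥0 → Ω → ℝ)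
    (ω : Ω) : ℝ :=
  Real.exp (-ℓ * (rateLoading p ((t N : ℝ) - t (N - 1)) * r (t (N - 1)) ω))

/-- The factor `b = max(W(s) - π_{N-1}, 0) exp(-α Δ) exp(r(s) (1 - exp(-κ Δ)) / κ)`. -/
def coeffB {Ω : Type*} (p : MarketParams) (W₀ α : ℝ) (t : ℕ → ℝ≥0) (N : ℕ) (r S : ℝ≥0 → Ω → ℝ)
    (π : ℕ → Ω → ℝ) (ω : Ω) : ℝ :=
  max (wealthAccount W₀ α t S π (N - 1) ω - π (N - 1) ω) 0 *
    Real.exp (-α * ((t N : ℝ) - t (N - 1))) *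
    Real.exp (rateLoading p ((t N : ℝ) - t (N - 1)) * r (t (N - 1)) ω)

/-! Means, standard deviations and correlation of `Y` and `E` for a period of length `Δ`. -/

def meanY (p : MarketParams) (Δ : ℝ) : ℝ := p.θ * (Δ - (1 - Real.exp (-p.κ * Δ)) / p.κ)

def sdY (p : MarketParams) (Δ : ℝ) : ℝ :=
  √(p.σr ^ 2 / p.κ ^ 2 * (Δ - 2 / p.κ * (1 - Real.exp (-p.κ * Δ)) +
    1 / (2 * p.κ) * (1 - Real.exp (-2 * p.κ * Δ))))

def meanE (p : MarketParams) (Δ : ℝ) : ℝ := -(1 / 2) * p.σS ^ 2 * Δ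

def sdE (p : MarketParams) (Δ : ℝ) : ℝ := √(p.σS ^ 2 * Δ)

def corrYE (p : MarketParams) (Δ : ℝ) : ℝ :=
  p.ρ * p.σr * p.σS / (p.κ * sdY p Δ * sdE p Δ) * (Δ - 1 / p.κ * (1 - Real.exp (-p.κ * Δ)))

/-! Parameters of `X₁ = log b + (1 - ℓ) Y + E` and `X₂ = log c - ℓ Y`. -/

def m₁ (p : MarketParams) (ℓ Δ b : ℝ) : ℝ := Real.log b + (1 - ℓ) * meanY p Δ + meanE p Δ

def m₂ (p : MarketParams) (ℓ Δ c : ℝ) : ℝ := Real.log c - ℓ * meanY p Δ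

def σ₁ (p : MarketParams) (ℓ Δ : ℝ) : ℝ :=
  √((1 - ℓ) ^ 2 * sdY p Δ ^ 2 + sdE p Δ ^ 2 + 2 * (1 - ℓ) * corrYE p Δ * sdY p Δ * sdE p Δ)

def σ₂ (p : MarketParams) (ℓ Δ : ℝ) : ℝ := ℓ * sdY p Δ

def ρ₁₂ (p : MarketParams) (ℓ Δ : ℝ) : ℝ :=
  (-(1 - ℓ) * sdY p Δ - sdE p Δ * corrYE p Δ) /
    √((1 - ℓ) ^ 2 * sdY p Δ ^ 2 + sdE p Δ ^ 2 + 2 * (1 - ℓ) * corrYE p Δ * sdY p Δ * sdE p Δ)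

/-- The cumulative distribution function of the standard normal distribution. -/
def stdNormalCDF (x : ℝ) : ℝ := cdf (gaussianReal 0 1) x

/-- The value of the conditional expectation when `b = 0`. -/
def valueB0 (p : MarketParams) (ℓ Δ a c : ℝ) : ℝ :=
  a * c * Real.exp (-ℓ * meanY p Δ + ℓ ^ 2 * sdY p Δ ^ 2 / 2)

/-- The value of the conditional expectation when `c = 0`. -/
def valueC0 (p : MarketParams) (ℓ Δ a b : ℝ) : ℝ :=
  a * b * Real.exp ((1 - ℓ) * meanY p Δ + meanE p Δ +
    ((1 - ℓ) ^ 2 * sdY p Δ ^ 2 + sdE p Δ ^ 2 + 2 * (1 - ℓ) * corrYE p Δ * sdY p Δ * sdE p Δ) / 2)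

/-- The value of the conditional expectation when `b > 0` and `c > 0`. -/
def valuePos (p : MarketParams) (ℓ Δ a b c : ℝ) : ℝ :=
  a * Real.exp (m₁ p ℓ Δ b + σ₁ p ℓ Δ ^ 2 / 2) *
      stdNormalCDF ((m₁ p ℓ Δ b - m₂ p ℓ Δ c + σ₁ p ℓ Δ ^ 2 - ρ₁₂ p ℓ Δ * σ₁ p ℓ Δ * σ₂ p ℓ Δ) /
        √(σ₁ p ℓ Δ ^ 2 + σ₂ p ℓ Δ ^ 2 - 2 * ρ₁₂ p ℓ Δ * σ₁ p ℓ Δ * σ₂ p ℓ Δ)) +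
    a * Real.exp (m₂ p ℓ Δ c + σ₂ p ℓ Δ ^ 2 / 2) *
      stdNormalCDF ((m₂ p ℓ Δ c - m₁ p ℓ Δ b + σ₂ p ℓ Δ ^ 2 - ρ₁₂ p ℓ Δ * σ₁ p ℓ Δ * σ₂ p ℓ Δ) /
        √(σ₁ p ℓ Δ ^ 2 + σ₂ p ℓ Δ ^ 2 - 2 * ρ₁₂ p ℓ Δ * σ₁ p ℓ Δ * σ₂ p ℓ Δ))

end

/-!
Over the last period `[s, t]` the market reduces to a Gaussian pair `(Y, E)` that is independent of
`𝓕 s`, and the valuation is a conditional expectation with the state at `s` frozen.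

*The short rate.* The equation for `r` is solved pathwise, without stochastic integration: it is a
linear differential equation for `R(u) = ∫_s^u r`, and an integrating factor gives
`Y = meanY + σr ∫_s^t exp(-κ (t - v)) (B₁(v) - B₁(s)) dv`
(`integral_eq_of_integral_equation`, `IsMarketModel.noiseY_ae_eq`). After summation by parts this
functional is a limit of sums `∑ f(v_j) (B₁(v_{j+1}) - B₁(v_j))` with
`f(v) = (1 - exp(-κ (t - v))) / κ`.

*Law and independence.* The increments of `(B₁, B₂)` along a grid are independent of each other and
of the past one step at a time, so the joint characteristic function of these sums and of the
increments over `[s, t]`, restricted to an event of `𝓕 s`, is explicit. Passing to the limit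
(`IsWienerPair.integral_indicator_cexp_weightedPath`) yields at once that all combinations
`x Y + y E` are normal, with the stated moments, and that `(Y, E)` is independent of `𝓕 s`.

*The asset price.* The equation for `S` only says that the sums of `(S_{k+1} - S_k) / S_k` converge
in probability to `J = ∫ r + σS N`, with `N` the driving noise; it is not assumed that `S` is a
semimartingale. With `L = log S`, these are sums of `exp(ΔL) - 1`. Since `exp x - 1 - x ≥ 0`, the
process `M = J - (L - L(0))`, the limit of the sums of `exp(ΔL) - 1 - ΔL`, is nondecreasing. As `M`
and `∫ r` are continuous and of bounded variation, they do not contribute to the sums of squares of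
`L = L(0) + J - M`, which therefore converge to `σS² t`. By Taylor expansion the sums of
`exp(ΔL) - 1 - ΔL` converge to half of this, so that `M = σS² t / 2`, that is,
`log (S(t) / S(0)) = ∫ r + σS N - σS² t / 2` (`eq_half_sq_mul_of_tendsto`,
`IsMarketModel.ae_log_sub_log_zero`).

*The value.* The discounted payoff equals `a exp(-ℓ Y) max(b exp(Y + E), c)` with `a`, `b`, `c`
known at `s`, and it is dominated by exponentials of normal variables. Freezing `a`, `b`, `c` reduces the
claim to expectations over `(Y, E)`. For `b, c > 0` the integrand is `exp(max(X₁, X₂))`, and each of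
the events `X₁ ≥ X₂`, `X₁ < X₂` is evaluated under the measure with density proportional to
`exp(X₁)`, respectively `exp(X₂)` (`integral_exp_max_of_gaussian`). The denominators are positive by
the strict Cauchy–Schwarz inequality `covYE_sq_lt`: as `f` is not constant, `Y` and `E` are never
proportional, even for `|ρ| = 1`.
-/

noncomputable section

/-! ### Increments of the driving Wiener processes -/

namespace IsWienerPair

variable {Ω : Type*} {mΩ : MeasurableSpace Ω} {μ : Measure Ω}
  {𝓕 : Filtration ℝ≥0 mΩ} {B₁ B₂ : ℝ≥0 → Ω → ℝ}

lemma measurable₁ (h : IsWienerPair μ 𝓕 B₁ B₂) (t : ℝ≥0) : Measurable (B₁ t) :=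
  (h.adapted₁ t).mono (𝓕.le t) le_rfl

lemma measurable₂ (h : IsWienerPair μ 𝓕 B₁ B₂) (t : ℝ≥0) : Measurable (B₂ t) :=
  (h.adapted₂ t).mono (𝓕.le t) le_rfl

/-- A linear combination of the two increments over `[s, t]` is a centred normal variable. -/
lemma hasLaw_increment [IsProbabilityMeasure μ] (h : IsWienerPair μ 𝓕 B₁ B₂)
    {s t : ℝ≥0} (hst : s ≤ t) (p q : ℝ) :
    HasLaw (fun ω => p * (B₁ t ω - B₁ s ω) + q * (B₂ t ω - B₂ s ω))
      (gaussianReal 0 (((p ^ 2 + q ^ 2) * ((t : ℝ) - s)).toNNReal)) μ := by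
  have hd : (nndist t.1 s.1 : ℝ) = (t : ℝ) - s := by
    rw [coe_nndist, Real.dist_eq]
    exact abs_of_nonneg (sub_nonneg.2 (by exact_mod_cast hst))
  have h1 := gaussianReal_const_mul (h.brownian₁.hasLaw_sub t s) p
  have h2 := gaussianReal_const_mul (h.brownian₂.hasLaw_sub t s) q
  have hind : IndepFun (fun ω => p * (B₁ t - B₁ s) ω) (fun ω => q * (B₂ t - B₂ s) ω) μ :=
    h.indep.comp (φ := fun x : ℝ≥0 → ℝ => p * (x t - x s))
      (ψ := fun x : ℝ≥0 → ℝ => q * (x t - x s)) (by fun_prop) (by fun_prop)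
  refine ⟨?_, ?_⟩
  · have := h.measurable₁; have := h.measurable₂; fun_prop
  · have := gaussianReal_add_gaussianReal_of_indepFun hind h1.map_eq h2.map_eq
    refine Eq.trans ?_ (this.trans ?_)
    · rfl
    · congr 1
      · simp
      · ext
        rw [Real.coe_toNNReal _ (by rw [← hd]; positivity), ← hd]
        simp only [NNReal.coe_add, NNReal.coe_mul, NNReal.coe_mk]
        ring

/-- The increment over `[s, t]` factors out of the characteristic function of any
`𝓕 s`-measurable quantity. -/
lemma integral_mul_cexp_increment [IsProbabilityMeasure μ] (h : IsWienerPair μ 𝓕 B₁ B₂)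
    {s t : ℝ≥0} (hst : s ≤ t)
    (p q : ℝ) {G : Ω → ℂ} (hG : Measurable[𝓕 s] G) :
    ∫ ω, G ω * Complex.exp
        (((p * (B₁ t ω - B₁ s ω) + q * (B₂ t ω - B₂ s ω) : ℝ) : ℂ) * Complex.I) ∂μ =
      (∫ ω, G ω ∂μ) *
        Complex.exp (-(((p ^ 2 + q ^ 2) * ((t : ℝ) - s) : ℝ) : ℂ) / 2) := by
  have hm1 := h.measurable₁; have hm2 := h.measurable₂
  have hd : 0 ≤ (p ^ 2 + q ^ 2) * ((t : ℝ) - s) := by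
    have : (0 : ℝ) ≤ (t : ℝ) - s := sub_nonneg.2 (by exact_mod_cast hst)
    positivity
  have hind : IndepFun G (fun ω => (B₁ t ω - B₁ s ω, B₂ t ω - B₂ s ω)) μ := by
    rw [IndepFun_iff_Indep]
    exact indep_of_indep_of_le_left (h.indep_past s t hst).symm hG.comap_le
  have hGm : Measurable G := hG.mono (𝓕.le s) le_rfl
  have key := hind.integral_fun_comp_mul_comp (f := fun z : ℂ => z)
    (g := fun x : ℝ × ℝ => Complex.exp (((p * x.1 + q * x.2 : ℝ) : ℂ) * Complex.I))
    hGm.aemeasurable (by fun_prop) (by fun_prop)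
    (Measurable.aestronglyMeasurable (by fun_prop))
  refine key.trans ?_
  congr 1
  have hc := congrArg (fun ν => charFun ν 1) (h.hasLaw_increment hst p q).map_eq
  simp only [charFun_gaussianReal] at hc
  rw [charFun_apply, integral_map (h.hasLaw_increment hst p q).aemeasurable (by fun_prop)] at hc
  simp only [RCLike.inner_apply, conj_trivial, one_mul] at hc
  rw [hc, Real.coe_toNNReal _ hd]
  congr 1
  push_cast
  ring

/-- Joint characteristic function of the increments along a grid, on an event known at the first
grid point: the increments are independent of the past and of each other, and normal. -/
lemma integral_indicator_cexp_sum [IsProbabilityMeasure μ] (h : IsWienerPair μ 𝓕 B₁ B₂)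
    {u : ℕ → ℝ≥0} (hu : Monotone u)
    (p q : ℕ → ℝ) {A : Set Ω} (hA : MeasurableSet[𝓕 (u 0)] A) (n : ℕ) :
    ∫ ω, A.indicator (fun _ => (1 : ℂ)) ω * Complex.exp
        (((∑ j ∈ Finset.range n, (p j * (B₁ (u (j + 1)) ω - B₁ (u j) ω) +
          q j * (B₂ (u (j + 1)) ω - B₂ (u j) ω)) : ℝ) : ℂ) * Complex.I) ∂μ =
      μ.real A * Complex.exp (-((∑ j ∈ Finset.range n,
        (p j ^ 2 + q j ^ 2) * ((u (j + 1) : ℝ) - u j) : ℝ) : ℂ) / 2) := by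
  induction n with
  | zero =>
    simp [integral_indicator_const _ ((𝓕.le _) A hA)]
  | succ n ih =>
    have hmeas : Measurable[𝓕 (u n)] fun ω => A.indicator (fun _ => (1 : ℂ)) ω * Complex.exp
        (((∑ j ∈ Finset.range n, (p j * (B₁ (u (j + 1)) ω - B₁ (u j) ω) +
          q j * (B₂ (u (j + 1)) ω - B₂ (u j) ω)) : ℝ) : ℂ) * Complex.I) := by
      have hsum : Measurable[𝓕 (u n)] fun ω =>
          ∑ j ∈ Finset.range n, (p j * (B₁ (u (j + 1)) ω - B₁ (u j) ω) +
            q j * (B₂ (u (j + 1)) ω - B₂ (u j) ω)) := by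
        refine Finset.measurable_fun_sum _ fun j hj => ?_
        have hj : j + 1 ≤ n := Finset.mem_range.1 hj
        have a1 := (h.adapted₁ (u (j + 1))).mono (𝓕.mono (hu hj)) le_rfl
        have a2 := (h.adapted₁ (u j)).mono (𝓕.mono (hu (by lia : j ≤ n))) le_rfl
        have b1 := (h.adapted₂ (u (j + 1))).mono (𝓕.mono (hu hj)) le_rfl
        have b2 := (h.adapted₂ (u j)).mono (𝓕.mono (hu (by lia : j ≤ n))) le_rfl
        exact ((a1.sub a2).const_mul _).add ((b1.sub b2).const_mul _)
      refine Measurable.mul (measurable_const.indicator (𝓕.mono (hu (Nat.zero_le n)) A hA)) ?_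
      exact Complex.measurable_exp.comp
        ((Complex.measurable_ofReal.comp hsum).mul measurable_const)
    have := h.integral_mul_cexp_increment (hu (Nat.le_succ n)) (p n) (q n) hmeas
    rw [ih] at this
    simp only [Finset.sum_range_succ]
    refine Eq.trans ?_ (this.trans ?_)
    · refine integral_congr_ae (Eventually.of_forall fun ω => ?_)
      simp only
      rw [mul_assoc, ← Complex.exp_add]
      congr 2
      push_cast
      ring
    · rw [mul_assoc, ← Complex.exp_add]
      congr 2
      push_cast
      ring

end IsWienerPair

/-! ### Riemann sums -/

/-- The uniform grid with `n + 1` steps on `[s, t]`, constant from the step `n + 1` on. -/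
def uniformGrid (s t : ℝ≥0) (n k : ℕ) : ℝ≥0 := s + (t - s) * min ((k : ℝ≥0) / (n + 1)) 1

lemma uniformGrid_zero (s t : ℝ≥0) (n : ℕ) : uniformGrid s t n 0 = s := by simp [uniformGrid]

lemma uniformGrid_of_le {s t : ℝ≥0} (hst : s ≤ t) {n k : ℕ} (hk : n + 1 ≤ k) :
    uniformGrid s t n k = t := by
  have : 1 ≤ (k : ℝ≥0) / (n + 1) := by
    rw [one_le_div (by positivity)]; exact_mod_cast hk
  rw [uniformGrid, min_eq_right this, mul_one, add_tsub_cancel_of_le hst]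

lemma monotone_uniformGrid (s t : ℝ≥0) (n : ℕ) : Monotone (uniformGrid s t n) := by
  intro j k hjk
  unfold uniformGrid
  gcongr

lemma uniformGrid_succ_sub_le (s t : ℝ≥0) (n k : ℕ) :
    (uniformGrid s t n (k + 1) : ℝ) - uniformGrid s t n k ≤
      (t - s : ℝ≥0) * (1 / ((n : ℝ) + 1)) := by
  unfold uniformGrid
  push_cast
  have h : min (((k : ℝ) + 1) / (n + 1)) 1 ≤ min ((k : ℝ) / (n + 1)) 1 + 1 / ((n : ℝ) + 1) := by
    rw [← min_add_add_right, ← add_div]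
    exact min_le_min le_rfl (le_add_of_nonneg_right (by positivity))
  nlinarith [(t - s : ℝ≥0).2, mul_le_mul_of_nonneg_left h (t - s : ℝ≥0).2]

lemma eventually_uniformGrid_mesh (s t : ℝ≥0) {ε : ℝ} (hε : 0 < ε) :
    ∀ᶠ n in atTop, ∀ k, (uniformGrid s t n (k + 1) : ℝ) - uniformGrid s t n k < ε := by
  have h := (tendsto_one_div_add_atTop_nhds_zero_nat (𝕜 := ℝ)).const_mul ((t - s : ℝ≥0) : ℝ)
  rw [mul_zero] at h
  filter_upwards [h.eventually_lt_const hε] with n hn k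
  exact (uniformGrid_succ_sub_le s t n k).trans_lt hn

/-- Riemann–Stieltjes sums of `b` against `g dv`, with arbitrary evaluation points, converge. -/
lemma tendsto_riemannSum {s t : ℝ} (hst : s ≤ t) {g b : ℝ → ℝ} (hg : Continuous g)
    (hb : Continuous b) {m : ℕ → ℕ} {u x : ℕ → ℕ → ℝ} (hu : ∀ n, Monotone (u n))
    (h0 : ∀ n, u n 0 = s) (h1 : ∀ n, u n (m n) = t)
    (hmesh : ∀ ε : ℝ, 0 < ε → ∀ᶠ n in atTop, ∀ k, u n (k + 1) - u n k < ε)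
    (hx : ∀ n k, x n k ∈ Set.Icc (u n k) (u n (k + 1))) :
    Tendsto (fun n => ∑ k ∈ Finset.range (m n), (∫ v in u n k..u n (k + 1), g v) * b (x n k))
      atTop (𝓝 (∫ v in s..t, g v * b v)) := by
  rw [Metric.tendsto_atTop']
  intro ε hε
  set I := ∫ v in s..t, |g v| with hI
  have hI0 : 0 ≤ I := intervalIntegral.integral_nonneg hst fun _ _ => abs_nonneg _
  have huc : UniformContinuousOn b (Set.Icc s t) :=
    isCompact_Icc.uniformContinuousOn_of_continuous hb.continuousOn
  obtain ⟨δ, hδ, hbδ⟩ := Metric.uniformContinuousOn_iff.1 huc (ε / (I + 1)) (by positivity)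
  obtain ⟨n₀, hn₀⟩ := eventually_atTop.1 (hmesh δ hδ)
  refine ⟨n₀, fun n hn => ?_⟩
  have hsplit : ∀ {φ : ℝ → ℝ}, Continuous φ →
      ∫ v in s..t, φ v = ∑ k ∈ Finset.range (m n), ∫ v in u n k..u n (k + 1), φ v := by
    intro φ hφ
    rw [intervalIntegral.sum_integral_adjacent_intervals
      (fun k _ => hφ.intervalIntegrable _ _), h0, h1]
  have hterm : ∀ k ∈ Finset.range (m n),
      |(∫ v in u n k..u n (k + 1), g v) * b (x n k) - ∫ v in u n k..u n (k + 1), g v * b v| ≤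
        ε / (I + 1) * ∫ v in u n k..u n (k + 1), |g v| := by
    intro k hk
    have hk := Finset.mem_range.1 hk
    have hle : u n k ≤ u n (k + 1) := hu n k.le_succ
    have hsk : s ≤ u n k := h0 n ▸ hu n (Nat.zero_le k)
    have hkt : u n (k + 1) ≤ t := h1 n ▸ hu n hk
    rw [← intervalIntegral.integral_mul_const, ← intervalIntegral.integral_sub
      (Continuous.intervalIntegrable (by fun_prop) _ _)
      (Continuous.intervalIntegrable (by fun_prop) _ _),
      ← intervalIntegral.integral_const_mul]
    refine (intervalIntegral.abs_integral_le_integral_abs hle).trans ?_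
    refine intervalIntegral.integral_mono_on hle (Continuous.intervalIntegrable (by fun_prop) _ _)
      (Continuous.intervalIntegrable (by fun_prop) _ _) fun v hv => ?_
    rw [← mul_sub, abs_mul, mul_comm]
    refine mul_le_mul_of_nonneg_right ?_ (abs_nonneg _)
    have hxk := hx n k
    have := hbδ (x n k) ⟨hsk.trans hxk.1, hxk.2.trans hkt⟩ v ⟨hsk.trans hv.1, hv.2.trans hkt⟩
      (by
        rw [Real.dist_eq, abs_lt]
        have := hn₀ n hn.le k
        constructor <;> linarith [hxk.1, hxk.2, hv.1, hv.2])
    exact this.le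
  rw [hsplit (φ := fun v => g v * b v) (hg.mul hb), Real.dist_eq, ← Finset.sum_sub_distrib]
  calc _ ≤ ∑ k ∈ Finset.range (m n), ε / (I + 1) * ∫ v in u n k..u n (k + 1), |g v| :=
        (Finset.abs_sum_le_sum_abs _ _).trans (Finset.sum_le_sum hterm)
    _ = ε / (I + 1) * I := by rw [← Finset.mul_sum, hI, hsplit hg.abs]
    _ < ε := by
      rw [div_mul_eq_mul_div, div_lt_iff₀ (by positivity)]
      nlinarith

/-! ### The Gaussian functional of the driving path -/

/-- The loading `(1 - exp(-κ (t - v))) / κ` of the increment `dB(v)` in `∫_s^t r`. -/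
def loading (κ t v : ℝ) : ℝ := (1 - Real.exp (-κ * (t - v))) / κ

/-- `∫_s^t exp(-κ (t - v)) (B(v) - B(s)) dv`, which is the Wiener integral
`∫_s^t (1 - exp(-κ (t - v))) / κ dB(v)` after an integration by parts. -/
def weightedPath {Ω : Type*} (κ : ℝ) (B : ℝ≥0 → Ω → ℝ) (s t : ℝ≥0) (ω : Ω) : ℝ :=
  ∫ v in (s : ℝ)..t, Real.exp (-κ * (t - v)) * (B v.toNNReal ω - B s ω)

lemma continuous_loading (κ t : ℝ) : Continuous (loading κ t) := by
  unfold loading; fun_prop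

lemma integral_exp_eq_loading_sub {κ : ℝ} (hκ : κ ≠ 0) (t x y : ℝ) :
    ∫ v in x..y, Real.exp (-κ * (t - v)) = loading κ t x - loading κ t y := by
  have hd : ∀ v ∈ Set.uIcc x y,
      HasDerivAt (fun v => -loading κ t v) (Real.exp (-κ * (t - v))) v := by
    intro v _
    have h1 : HasDerivAt (fun v : ℝ => -κ * (t - v)) κ v := by
      simpa using ((hasDerivAt_id v).const_sub t).const_mul (-κ)
    have h2 := ((h1.exp.const_sub 1).div_const κ).neg
    refine h2.congr_deriv ?_
    field_simp
  rw [intervalIntegral.integral_eq_sub_of_hasDerivAt hd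
    (Continuous.intervalIntegrable (by fun_prop) _ _)]
  ring

lemma sum_mul_sub_eq_sum_sub_mul (f b : ℕ → ℝ) (n : ℕ) :
    ∑ j ∈ Finset.range n, f j * (b (j + 1) - b j) =
      f n * b n - f 0 * b 0 + ∑ j ∈ Finset.range n, (f j - f (j + 1)) * b (j + 1) := by
  induction n with
  | zero => simp
  | succ n ih => rw [Finset.sum_range_succ, Finset.sum_range_succ, ih]; ring

/-- On a continuous path, the left-endpoint sums of `loading dB` converge to `weightedPath`. -/
lemma tendsto_sum_loading_mul_increment {Ω : Type*} {κ : ℝ} (hκ : κ ≠ 0) {B : ℝ≥0 → Ω → ℝ}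
    {s t : ℝ≥0} (hst : s ≤ t) {ω : Ω} (hB : Continuous fun v => B v ω) :
    Tendsto (fun n : ℕ => ∑ j ∈ Finset.range (n + 1), loading κ t (uniformGrid s t n j) *
      (B (uniformGrid s t n (j + 1)) ω - B (uniformGrid s t n j) ω)) atTop
      (𝓝 (weightedPath κ B s t ω)) := by
  have hb : Continuous fun v : ℝ => B v.toNNReal ω - B s ω :=
    (hB.comp continuous_real_toNNReal).sub continuous_const
  have h := tendsto_riemannSum (s := s) (t := t) (g := fun v => Real.exp (-κ * (t - v)))
    (by exact_mod_cast hst) (by fun_prop) hb (m := fun n => n + 1)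
    (u := fun n k => uniformGrid s t n k) (x := fun n k => uniformGrid s t n (k + 1))
    (fun n => NNReal.coe_mono.comp (monotone_uniformGrid s t n))
    (fun n => by rw [uniformGrid_zero]) (fun n => by rw [uniformGrid_of_le hst le_rfl])
    (fun ε hε => eventually_uniformGrid_mesh s t hε)
    (fun n k => ⟨NNReal.coe_mono (monotone_uniformGrid s t n k.le_succ), le_rfl⟩)
  refine h.congr fun n => ?_
  have hab := sum_mul_sub_eq_sum_sub_mul (fun j => loading κ t (uniformGrid s t n j))
    (fun j => B (uniformGrid s t n j) ω - B s ω) (n + 1)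
  simp only [uniformGrid_zero, uniformGrid_of_le hst le_rfl, sub_self, mul_zero, sub_zero,
    sub_sub_sub_cancel_right] at hab
  rw [hab]
  simp only [integral_exp_eq_loading_sub hκ, Real.toNNReal_coe]
  simp [loading]

namespace IsWienerPair

variable {Ω : Type*} {mΩ : MeasurableSpace Ω} {μ : Measure Ω}
  {𝓕 : Filtration ℝ≥0 mΩ} {B₁ B₂ : ℝ≥0 → Ω → ℝ}

lemma aemeasurable_weightedPath (h : IsWienerPair μ 𝓕 B₁ B₂) {κ : ℝ} (hκ : κ ≠ 0)
    {s t : ℝ≥0} (hst : s ≤ t) : AEMeasurable (weightedPath κ B₁ s t) μ := by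
  refine aemeasurable_of_tendsto_metrizable_ae atTop (f := fun (n : ℕ) ω =>
    ∑ j ∈ Finset.range (n + 1), loading κ t (uniformGrid s t n j) *
      (B₁ (uniformGrid s t n (j + 1)) ω - B₁ (uniformGrid s t n j) ω)) (fun n => ?_) ?_
  · have := h.measurable₁
    fun_prop
  · filter_upwards [h.brownian₁.cont] with ω hω
    exact tendsto_sum_loading_mul_increment hκ hst hω

/-- Joint characteristic function of `weightedPath` and the two increments over `[s, t]`, on an
event of `𝓕 s`. -/
lemma integral_indicator_cexp_weightedPath [IsProbabilityMeasure μ]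
    (h : IsWienerPair μ 𝓕 B₁ B₂) {κ : ℝ} (hκ : κ ≠ 0) {s t : ℝ≥0} (hst : s ≤ t)
    (x y z : ℝ) {A : Set Ω} (hA : MeasurableSet[𝓕 s] A) :
    ∫ ω, A.indicator (fun _ => (1 : ℂ)) ω * Complex.exp
        (((x * weightedPath κ B₁ s t ω + y * (B₁ t ω - B₁ s ω) + z * (B₂ t ω - B₂ s ω) : ℝ) : ℂ) *
          Complex.I) ∂μ =
      μ.real A * Complex.exp
        (-((∫ v in (s : ℝ)..t, ((x * loading κ t v + y) ^ 2 + z ^ 2) : ℝ) : ℂ) / 2) := by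
  have hm1 := h.measurable₁; have hm2 := h.measurable₂
  have key : ∀ n : ℕ, _ := fun n => h.integral_indicator_cexp_sum (monotone_uniformGrid s t n)
    (fun j => x * loading κ t (uniformGrid s t n j) + y) (fun _ => z)
    (by rwa [uniformGrid_zero]) (n + 1)
  have hsum : ∀ (n : ℕ) ω, ∑ j ∈ Finset.range (n + 1),
      ((x * loading κ t (uniformGrid s t n j) + y) *
        (B₁ (uniformGrid s t n (j + 1)) ω - B₁ (uniformGrid s t n j) ω) +
        z * (B₂ (uniformGrid s t n (j + 1)) ω - B₂ (uniformGrid s t n j) ω)) =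
      x * (∑ j ∈ Finset.range (n + 1), loading κ t (uniformGrid s t n j) *
        (B₁ (uniformGrid s t n (j + 1)) ω - B₁ (uniformGrid s t n j) ω)) +
        y * (B₁ t ω - B₁ s ω) + z * (B₂ t ω - B₂ s ω) := by
    intro n ω
    simp only [add_mul, Finset.sum_add_distrib, mul_assoc, ← Finset.mul_sum]
    rw [Finset.sum_range_sub (fun j => B₁ (uniformGrid s t n j) ω),
      Finset.sum_range_sub (fun j => B₂ (uniformGrid s t n j) ω), uniformGrid_zero,
      uniformGrid_of_le hst le_rfl]
  simp only [hsum] at key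
  refine tendsto_nhds_unique (f := fun n : ℕ => ∫ ω, A.indicator (fun _ => (1 : ℂ)) ω * Complex.exp
        (((x * (∑ j ∈ Finset.range (n + 1), loading κ t (uniformGrid s t n j) *
        (B₁ (uniformGrid s t n (j + 1)) ω - B₁ (uniformGrid s t n j) ω)) +
        y * (B₁ t ω - B₁ s ω) + z * (B₂ t ω - B₂ s ω) : ℝ) : ℂ) * Complex.I) ∂μ) (l := atTop) ?_ ?_
  · refine tendsto_integral_of_dominated_convergence (fun _ => 1) (fun n => ?_)
      (integrable_const _) (fun n => Eventually.of_forall fun ω => ?_) ?_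
    · refine AEStronglyMeasurable.mul
        ((measurable_const.indicator (𝓕.le _ A hA)).aestronglyMeasurable)
        (Measurable.aestronglyMeasurable ?_)
      fun_prop
    · rw [norm_mul, Complex.norm_exp_ofReal_mul_I, mul_one]
      exact (norm_indicator_le_norm_self _ _).trans (by simp)
    · filter_upwards [h.brownian₁.cont] with ω hω
      have hc : Continuous fun w : ℝ => A.indicator (fun _ => (1 : ℂ)) ω * Complex.exp
        (((x * w + y * (B₁ t ω - B₁ s ω) + z * (B₂ t ω - B₂ s ω) : ℝ) : ℂ) * Complex.I) := by
        fun_prop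
      exact (hc.tendsto _).comp (tendsto_sum_loading_mul_increment hκ hst hω)
  · simp only [key]
    have hl := continuous_loading κ t
    have hr := tendsto_riemannSum (s := s) (t := t) (g := fun _ => 1)
      (b := fun v => (x * loading κ t v + y) ^ 2 + z ^ 2)
      (by exact_mod_cast hst) (by fun_prop) (by fun_prop) (m := fun n => n + 1)
      (u := fun n k => uniformGrid s t n k) (x := fun n k => uniformGrid s t n k)
      (fun n => NNReal.coe_mono.comp (monotone_uniformGrid s t n))
      (fun n => by rw [uniformGrid_zero]) (fun n => by rw [uniformGrid_of_le hst le_rfl])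
      (fun ε hε => eventually_uniformGrid_mesh s t hε)
      (fun n k => ⟨le_rfl, NNReal.coe_mono (monotone_uniformGrid s t n k.le_succ)⟩)
    simp only [intervalIntegral.integral_const, smul_eq_mul, mul_one, one_mul] at hr
    have hc : Continuous fun w : ℝ => (μ.real A : ℂ) * Complex.exp (-(w : ℂ) / 2) := by fun_prop
    refine ((hc.tendsto _).comp hr).congr fun n => ?_
    simp only [Function.comp, mul_comm]

end IsWienerPair

/-! ### The integrated short rate -/

lemma integral_exp_mul_sub {κ : ℝ} (hκ : κ ≠ 0) (s t : ℝ) :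
    ∫ v in s..t, Real.exp (-κ * (t - v)) * (κ * (v - s)) = (t - s) - loading κ t s := by
  have hd : ∀ v ∈ Set.uIcc s t, HasDerivAt (fun v => Real.exp (-κ * (t - v)) * ((v - s) - 1 / κ))
      (Real.exp (-κ * (t - v)) * (κ * (v - s))) v := by
    intro v _
    have h1 : HasDerivAt (fun v : ℝ => -κ * (t - v)) κ v := by
      simpa using ((hasDerivAt_id v).const_sub t).const_mul (-κ)
    have h2 : HasDerivAt (fun v : ℝ => (v - s) - 1 / κ) 1 v :=
      ((hasDerivAt_id v).sub_const s).sub_const _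
    refine (h1.exp.mul h2).congr_deriv ?_
    field_simp
    ring
  rw [intervalIntegral.integral_eq_sub_of_hasDerivAt hd
    (Continuous.intervalIntegrable (by fun_prop) _ _)]
  simp only [sub_self, mul_zero, Real.exp_zero, loading]
  field_simp
  ring

/-- The linear equation `R' = r(s) + κ θ (u - s) - κ R + σ (B(u) - B(s))` for `R(u) = ∫_s^u r`,
solved by the integrating factor `exp (κ u)`. -/
lemma integral_eq_of_integral_equation {κ θ σ s t : ℝ} (hκ : κ ≠ 0) (hst : s ≤ t) {r B : ℝ → ℝ}
    (hr : Continuous r) (hB : Continuous B)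
    (h : ∀ u ∈ Set.Icc s t,
      r u = r s + κ * θ * (u - s) - κ * (∫ v in s..u, r v) + σ * (B u - B s)) :
    ∫ v in s..t, r v = loading κ t s * r s + θ * ((t - s) - loading κ t s) +
      σ * ∫ v in s..t, Real.exp (-κ * (t - v)) * (B v - B s) := by
  have hR : ∀ u, HasDerivAt (fun u => ∫ v in s..u, r v) (r u) u := fun u =>
    intervalIntegral.integral_hasDerivAt_right (hr.intervalIntegrable _ _)
      (hr.stronglyMeasurableAtFilter _ _) hr.continuousAt
  have hRc : Continuous fun u => ∫ v in s..u, r v :=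
    continuous_iff_continuousAt.2 fun u => (hR u).continuousAt
  have hd : ∀ u ∈ Set.uIcc s t, HasDerivAt (fun u => Real.exp (-κ * (t - u)) * ∫ v in s..u, r v)
      (Real.exp (-κ * (t - u)) * (κ * (∫ v in s..u, r v) + r u)) u := by
    intro u _
    have h1 : HasDerivAt (fun v : ℝ => -κ * (t - v)) κ u := by
      simpa using ((hasDerivAt_id u).const_sub t).const_mul (-κ)
    refine (h1.exp.mul (hR u)).congr_deriv ?_
    ring
  have hint := intervalIntegral.integral_eq_sub_of_hasDerivAt hd
    (Continuous.intervalIntegrable (by fun_prop) _ _)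
  simp only [sub_self, mul_zero, Real.exp_zero, one_mul, intervalIntegral.integral_same,
    sub_zero] at hint
  rw [← hint]
  have hcongr : ∫ u in s..t, Real.exp (-κ * (t - u)) * (κ * (∫ v in s..u, r v) + r u) =
      ∫ u in s..t, ((Real.exp (-κ * (t - u)) * r s + θ * (Real.exp (-κ * (t - u)) *
        (κ * (u - s)))) + σ * (Real.exp (-κ * (t - u)) * (B u - B s))) := by
    refine intervalIntegral.integral_congr fun u hu => ?_
    rw [Set.uIcc_of_le hst] at hu
    rw [h u hu]
    ring
  rw [hcongr, intervalIntegral.integral_add, intervalIntegral.integral_add,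
    intervalIntegral.integral_mul_const, intervalIntegral.integral_const_mul,
    intervalIntegral.integral_const_mul, integral_exp_eq_loading_sub hκ, integral_exp_mul_sub hκ]
  · simp [loading]
  all_goals exact Continuous.intervalIntegrable (by fun_prop) _ _

namespace IsMarketModel

variable {Ω : Type*} {mΩ : MeasurableSpace Ω} {μ : Measure Ω}
  {𝓕 : Filtration ℝ≥0 mΩ} {p : MarketParams} {r₀ S₀ : ℝ} {B₁ B₂ r S : ℝ≥0 → Ω → ℝ}

lemma continuous_rate (h : IsMarketModel μ 𝓕 p r₀ S₀ B₁ B₂ r S) (ω : Ω) :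
    Continuous fun u : ℝ => r u.toNNReal ω :=
  (h.continuous_r ω).comp continuous_real_toNNReal

/-- The short rate equation restarted at time `s`, with the time integral of `r` isolated. -/
lemma ae_rate_eq (h : IsMarketModel μ 𝓕 p r₀ S₀ B₁ B₂ r S) :
    ∀ᵐ ω ∂μ, ∀ s u : ℝ≥0, r u ω = r s ω + p.κ * p.θ * ((u : ℝ) - s) -
      p.κ * timeIntegral r s u ω + p.σr * (B₁ u ω - B₁ s ω) := by
  filter_upwards [h.sde_r] with ω hω s u
  have hc := h.continuous_rate ω
  have hI : ∀ x y : ℝ, IntervalIntegrable (fun v : ℝ => r v.toNNReal ω) volume x y :=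
    fun x y => hc.intervalIntegrable x y
  have hT : ∀ t : ℝ≥0, timeIntegral (fun u ω => p.κ * (p.θ - r u ω)) 0 t ω =
      p.κ * (p.θ * t - timeIntegral r 0 t ω) := by
    intro t
    unfold timeIntegral
    rw [intervalIntegral.integral_const_mul, intervalIntegral.integral_sub
      (continuous_const.intervalIntegrable _ _) (hI _ _)]
    simp [mul_comm]
  have hadd : timeIntegral r 0 s ω + timeIntegral r s u ω = timeIntegral r 0 u ω :=
    intervalIntegral.integral_add_adjacent_intervals (hI _ _) (hI _ _)
  rw [hω u, hω s, hT, hT, ← hadd]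
  ring

lemma timeIntegral_eq_add_noiseY (h : IsMarketModel μ 𝓕 p r₀ S₀ B₁ B₂ r S) (hκ : p.κ ≠ 0)
    {s t : ℝ≥0} (hst : s ≤ t) (ω : Ω) :
    timeIntegral r s t ω = rateLoading p ((t : ℝ) - s) * r s ω + noiseY p r s t ω := by
  have hst' : (s : ℝ) ≤ t := by exact_mod_cast hst
  have hc := h.continuous_rate ω
  have h1 : noiseY p r s t ω = ∫ u in (s : ℝ)..t,
      (r u.toNNReal ω - Real.exp (-p.κ * (u - s)) * r s ω) := by
    refine intervalIntegral.integral_congr fun u hu => ?_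
    rw [Set.uIcc_of_le hst'] at hu
    simp only [Real.coe_toNNReal u (s.2.trans hu.1)]
  have h2 : ∫ u in (s : ℝ)..t, Real.exp (-p.κ * (u - s)) = rateLoading p ((t : ℝ) - s) := by
    have := integral_exp_eq_loading_sub (neg_ne_zero.2 hκ) s s t
    simp only [neg_neg] at this
    rw [rateLoading]
    refine Eq.trans ?_ (this.trans ?_)
    · congr 1; ext u; congr 1; ring
    · simp only [loading, sub_self, mul_zero, Real.exp_zero, zero_div, zero_sub]
      rw [show - -p.κ * ((s : ℝ) - t) = -p.κ * (t - s) by ring]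
      field_simp
  rw [h1, intervalIntegral.integral_sub (hc.intervalIntegrable _ _)
    (Continuous.intervalIntegrable (by fun_prop) _ _), intervalIntegral.integral_mul_const, h2,
    timeIntegral]
  ring

/-- `Y` is an affine function of the Gaussian functional `weightedPath`. -/
lemma noiseY_ae_eq (h : IsMarketModel μ 𝓕 p r₀ S₀ B₁ B₂ r S) (hκ : p.κ ≠ 0)
    {s t : ℝ≥0} (hst : s ≤ t) :
    ∀ᵐ ω ∂μ, noiseY p r s t ω = meanY p ((t : ℝ) - s) + p.σr * weightedPath p.κ B₁ s t ω := by
  have hst' : (s : ℝ) ≤ t := by exact_mod_cast hst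
  filter_upwards [h.ae_rate_eq, h.wiener.brownian₁.cont] with ω hω hB
  have h1 := integral_eq_of_integral_equation (κ := p.κ) (θ := p.θ) (σ := p.σr) hκ hst'
    (h.continuous_rate ω) (hB.comp continuous_real_toNNReal) (fun u hu => by
      have := hω s u.toNNReal
      rw [timeIntegral, Real.coe_toNNReal u (s.2.trans hu.1)] at this
      simpa using this)
  have h2 := h.timeIntegral_eq_add_noiseY hκ hst ω
  simp only [timeIntegral, h1] at h2
  simp only [Function.comp, Real.toNNReal_coe] at h2
  simp only [weightedPath, meanY, rateLoading, loading] at h2 ⊢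
  linarith

end IsMarketModel

/-! ### Second moments of the two factors -/

lemma integral_loading {κ : ℝ} (hκ : κ ≠ 0) (s t : ℝ) :
    ∫ v in s..t, loading κ t v = ((t - s) - loading κ t s) / κ := by
  unfold loading
  rw [intervalIntegral.integral_div, intervalIntegral.integral_sub
    (Continuous.intervalIntegrable (by fun_prop) _ _)
    (Continuous.intervalIntegrable (by fun_prop) _ _), integral_exp_eq_loading_sub hκ]
  simp [loading]

lemma integral_loading_sq {κ : ℝ} (hκ : κ ≠ 0) (s t : ℝ) :
    ∫ v in s..t, loading κ t v ^ 2 = 1 / κ ^ 2 * ((t - s) -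
      2 / κ * (1 - Real.exp (-κ * (t - s))) + 1 / (2 * κ) * (1 - Real.exp (-2 * κ * (t - s)))) := by
  have h2 := integral_exp_eq_loading_sub (mul_ne_zero two_ne_zero hκ) t s t
  have h : ∀ v, loading κ t v ^ 2 = (1 - 2 * Real.exp (-κ * (t - v)) +
      Real.exp (-(2 * κ) * (t - v))) * (1 / κ ^ 2) := by
    intro v
    rw [loading, show -(2 * κ) * (t - v) = -κ * (t - v) + -κ * (t - v) by ring, Real.exp_add]
    field_simp
    ring
  simp only [h]
  rw [intervalIntegral.integral_mul_const, intervalIntegral.integral_add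
    (Continuous.intervalIntegrable (by fun_prop) _ _)
    (Continuous.intervalIntegrable (by fun_prop) _ _), intervalIntegral.integral_sub
    (Continuous.intervalIntegrable (by fun_prop) _ _)
    (Continuous.intervalIntegrable (by fun_prop) _ _), intervalIntegral.integral_const_mul, h2,
    integral_exp_eq_loading_sub hκ]
  simp only [loading, intervalIntegral.integral_const, sub_self, mul_zero, Real.exp_zero]
  rw [show -(2 * κ) * (t - s) = -2 * κ * (t - s) by ring]
  simp only [smul_eq_mul]
  field_simp
  ring

/-- The covariance of `Y` and `E` over a period of length `Δ`. -/
def covYE (p : MarketParams) (Δ : ℝ) : ℝ :=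
  p.ρ * p.σr * p.σS / p.κ * (Δ - 1 / p.κ * (1 - Real.exp (-p.κ * Δ)))

/-- The variance of `x Y + y E` over a period of length `Δ`. -/
def varYE (p : MarketParams) (Δ x y : ℝ) : ℝ :=
  x ^ 2 * sdY p Δ ^ 2 + y ^ 2 * sdE p Δ ^ 2 + 2 * x * y * covYE p Δ

lemma sdE_sq (p : MarketParams) {Δ : ℝ} (hΔ : 0 ≤ Δ) : sdE p Δ ^ 2 = p.σS ^ 2 * Δ :=
  Real.sq_sqrt (by positivity)

lemma sdY_sq (p : MarketParams) (hκ : p.κ ≠ 0) {Δ : ℝ} (hΔ : 0 ≤ Δ) :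
    sdY p Δ ^ 2 = p.σr ^ 2 * ∫ v in (0 : ℝ)..Δ, loading p.κ Δ v ^ 2 := by
  have h0 : 0 ≤ ∫ v in (0 : ℝ)..Δ, loading p.κ Δ v ^ 2 :=
    intervalIntegral.integral_nonneg hΔ fun _ _ => sq_nonneg _
  rw [integral_loading_sq hκ, sub_zero] at h0 ⊢
  have h1 := mul_nonneg (sq_nonneg p.σr) h0
  have e : ∀ w : ℝ, p.σr ^ 2 / p.κ ^ 2 * w = p.σr ^ 2 * (1 / p.κ ^ 2 * w) := fun w => by ring
  rw [sdY, e, Real.sq_sqrt h1]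

/-- The variance appearing in the characteristic function of `x Y + y E`. -/
lemma integral_loading_combination (p : MarketParams) (hκ : p.κ ≠ 0) (hρ : p.ρ ∈ Set.Icc (-1 : ℝ) 1)
    {s t : ℝ} (hst : s ≤ t) (x y : ℝ) :
    ∫ v in s..t, ((x * p.σr * loading p.κ t v + y * p.σS * p.ρ) ^ 2 +
      (y * p.σS * √(1 - p.ρ ^ 2)) ^ 2) = varYE p (t - s) x y := by
  have hΔ : 0 ≤ t - s := sub_nonneg.2 hst
  have hl := continuous_loading p.κ t
  have hρ2 : √(1 - p.ρ ^ 2) ^ 2 = 1 - p.ρ ^ 2 := Real.sq_sqrt (by nlinarith [hρ.1, hρ.2])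
  have e : ∀ v, (x * p.σr * loading p.κ t v + y * p.σS * p.ρ) ^ 2 +
      (y * p.σS * √(1 - p.ρ ^ 2)) ^ 2 = x ^ 2 * p.σr ^ 2 * loading p.κ t v ^ 2 +
        2 * x * y * p.σr * p.σS * p.ρ * loading p.κ t v + y ^ 2 * p.σS ^ 2 := by
    intro v
    rw [mul_pow _ (√(1 - p.ρ ^ 2)), hρ2]
    ring
  simp only [e]
  rw [intervalIntegral.integral_add (Continuous.intervalIntegrable (by fun_prop) _ _)
    (Continuous.intervalIntegrable (by fun_prop) _ _), intervalIntegral.integral_add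
    (Continuous.intervalIntegrable (by fun_prop) _ _)
    (Continuous.intervalIntegrable (by fun_prop) _ _), intervalIntegral.integral_const_mul,
    intervalIntegral.integral_const_mul, integral_loading hκ, varYE, sdY_sq p hκ hΔ, sdE_sq p hΔ,
    integral_loading_sq hκ, integral_loading_sq hκ]
  simp only [intervalIntegral.integral_const, smul_eq_mul, sub_zero, covYE, loading]
  ring

lemma sinh_lt_mul_cosh {y : ℝ} (hy : 0 < y) : Real.sinh y < y * Real.cosh y := by
  obtain ⟨c, hc, h⟩ := exists_hasDerivAt_eq_slope Real.sinh Real.cosh hy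
    Real.continuous_sinh.continuousOn fun x _ => Real.hasDerivAt_sinh x
  rw [Real.sinh_zero, sub_zero, sub_zero, eq_div_iff hy.ne'] at h
  rw [← h, mul_comm]
  refine mul_lt_mul_of_pos_left (Real.cosh_lt_cosh.2 ?_) hy
  rw [abs_of_pos hc.1, abs_of_pos hy]
  exact hc.2

/-- The elementary form of the strict Cauchy–Schwarz inequality for `loading` and a constant. -/
lemma one_sub_exp_neg_sq_lt {x : ℝ} (hx : x ≠ 0) :
    (1 - Real.exp (-x)) ^ 2 < x * (1 - Real.exp (-(2 * x))) / 2 := by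
  -- after multiplication by `exp x`, both sides are even in `x = 2 y`
  have key : Real.sinh (x / 2) ^ 2 < x / 2 * Real.sinh (x / 2) * Real.cosh (x / 2) := by
    rcases lt_or_gt_of_ne hx with h | h
    · have h1 := sinh_lt_mul_cosh (y := -(x / 2)) (by linarith)
      have h2 : 0 < Real.sinh (-(x / 2)) := Real.sinh_pos_iff.2 (by linarith)
      rw [Real.cosh_neg] at h1
      rw [Real.sinh_neg] at h1 h2
      nlinarith
    · have h1 := sinh_lt_mul_cosh (y := x / 2) (by linarith)
      have h2 : 0 < Real.sinh (x / 2) := Real.sinh_pos_iff.2 (by linarith)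
      nlinarith
  have e1 : Real.exp (-x) = Real.exp (-(x / 2)) * Real.exp (-(x / 2)) := by
    rw [← Real.exp_add]; ring_nf
  have e2 : Real.exp (-(2 * x)) = Real.exp (-x) * Real.exp (-x) := by
    rw [← Real.exp_add]; ring_nf
  have e3 : Real.exp (x / 2) * Real.exp (-(x / 2)) = 1 := by
    rw [← Real.exp_add]; simp
  have h4 : 0 < Real.exp (-(x / 2)) := Real.exp_pos _
  rw [Real.sinh_eq, Real.cosh_eq] at key
  rw [e2, e1]
  generalize Real.exp (x / 2) = u at *
  generalize Real.exp (-(x / 2)) = w at *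
  have h5 := mul_lt_mul_of_pos_left key (by positivity : 0 < 4 * w ^ 2)
  have l : 4 * w ^ 2 * ((u - w) / 2) ^ 2 = (1 - w * w) ^ 2 := by
    linear_combination (u * w + 1 - 2 * w * w) * e3
  have r : 4 * w ^ 2 * (x / 2 * ((u - w) / 2) * ((u + w) / 2)) =
      x * (1 - w * w * (w * w)) / 2 := by
    linear_combination x / 2 * (u * w + 1) * e3
  rwa [l, r] at h5

/-- Strict Cauchy–Schwarz for the covariance: `Y` and `E` are never proportional, because the
loading of `Y` is not constant in time. -/
lemma covYE_sq_lt (p : MarketParams) (hκ : p.κ ≠ 0) (hσr : 0 < p.σr) (hσS : 0 < p.σS)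
    (hρ : p.ρ ∈ Set.Icc (-1 : ℝ) 1) {Δ : ℝ} (hΔ : 0 < Δ) :
    covYE p Δ ^ 2 < sdY p Δ ^ 2 * sdE p Δ ^ 2 := by
  rw [sdY_sq p hκ hΔ.le, sdE_sq p hΔ.le, integral_loading_sq hκ, sub_zero]
  have h := one_sub_exp_neg_sq_lt (mul_ne_zero hκ hΔ.ne')
  have hρ2 : p.ρ ^ 2 ≤ 1 := by nlinarith [hρ.1, hρ.2]
  rw [covYE]
  rw [show -(2 * (p.κ * Δ)) = -2 * p.κ * Δ by ring, show -(p.κ * Δ) = -p.κ * Δ by ring] at h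
  set e := Real.exp (-p.κ * Δ)
  set e2 := Real.exp (-2 * p.κ * Δ)
  have h1 : (p.ρ * p.σr * p.σS / p.κ * (Δ - 1 / p.κ * (1 - e))) ^ 2 ≤
      p.σr ^ 2 * p.σS ^ 2 / p.κ ^ 2 * (Δ - 1 / p.κ * (1 - e)) ^ 2 := by
    have e1 : (p.ρ * p.σr * p.σS / p.κ * (Δ - 1 / p.κ * (1 - e))) ^ 2 =
      p.ρ ^ 2 * (p.σr ^ 2 * p.σS ^ 2 / p.κ ^ 2 * (Δ - 1 / p.κ * (1 - e)) ^ 2) := by ring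
    rw [e1]
    exact mul_le_of_le_one_left (by positivity) hρ2
  refine h1.trans_lt ?_
  have e3 : p.σr ^ 2 * (1 / p.κ ^ 2 * (Δ - 2 / p.κ * (1 - e) + 1 / (2 * p.κ) * (1 - e2))) *
      (p.σS ^ 2 * Δ) = p.σr ^ 2 * p.σS ^ 2 / p.κ ^ 2 * ((Δ - 1 / p.κ * (1 - e)) ^ 2 +
        (p.κ * Δ * (1 - e2) / 2 - (1 - e) ^ 2) / p.κ ^ 2) := by
    field_simp
    ring
  rw [e3]
  have : 0 < (p.κ * Δ * (1 - e2) / 2 - (1 - e) ^ 2) / p.κ ^ 2 :=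
    div_pos (by linarith) (by positivity)
  exact mul_lt_mul_of_pos_left (by linarith) (by positivity)

lemma sdE_pos (p : MarketParams) (hσS : 0 < p.σS) {Δ : ℝ} (hΔ : 0 < Δ) : 0 < sdE p Δ :=
  Real.sqrt_pos.2 (by positivity)

lemma sdY_pos (p : MarketParams) (hκ : p.κ ≠ 0) (hσr : 0 < p.σr) (hσS : 0 < p.σS)
    (hρ : p.ρ ∈ Set.Icc (-1 : ℝ) 1) {Δ : ℝ} (hΔ : 0 < Δ) : 0 < sdY p Δ := by
  refine lt_of_le_of_ne (Real.sqrt_nonneg _) fun h => ?_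
  have := covYE_sq_lt p hκ hσr hσS hρ hΔ
  rw [← h] at this
  nlinarith [sq_nonneg (covYE p Δ)]

lemma corrYE_mul (p : MarketParams) (hκ : p.κ ≠ 0) (hσr : 0 < p.σr) (hσS : 0 < p.σS)
    (hρ : p.ρ ∈ Set.Icc (-1 : ℝ) 1) {Δ : ℝ} (hΔ : 0 < Δ) :
    corrYE p Δ * sdY p Δ * sdE p Δ = covYE p Δ := by
  have h1 := sdY_pos p hκ hσr hσS hρ hΔ
  have h2 := sdE_pos p hσS hΔ
  rw [corrYE, covYE]
  field_simp

/-- No combination `x Y + E` is degenerate. -/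
lemma varYE_pos (p : MarketParams) (hκ : p.κ ≠ 0) (hσr : 0 < p.σr) (hσS : 0 < p.σS)
    (hρ : p.ρ ∈ Set.Icc (-1 : ℝ) 1) {Δ : ℝ} (hΔ : 0 < Δ) (x : ℝ) : 0 < varYE p Δ x 1 := by
  have h1 := sdY_pos p hκ hσr hσS hρ hΔ
  have h2 := covYE_sq_lt p hκ hσr hσS hρ hΔ
  have h3 : 0 < sdY p Δ ^ 2 * varYE p Δ x 1 := by
    rw [varYE]
    nlinarith [sq_nonneg (x * sdY p Δ ^ 2 + covYE p Δ)]
  exact pos_of_mul_pos_right h3 (sq_nonneg _)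

/-! ### Exponential functionals of Gaussian pairs -/

/-- A normal moment generating function determines the law. -/
lemma map_eq_gaussianReal_of_mgf {Ω : Type*} {mΩ : MeasurableSpace Ω} {P : Measure Ω}
    [IsProbabilityMeasure P] {D : Ω → ℝ} (hD : AEMeasurable D P) {m : ℝ} {v : ℝ≥0}
    (h : ∀ z, mgf D P z = Real.exp (m * z + v * z ^ 2 / 2)) : P.map D = gaussianReal m v := by
  have hmgf : mgf D P = mgf id (gaussianReal m v) := by
    rw [mgf_id_gaussianReal]; exact funext h
  have hset : integrableExpSet D P = Set.univ := by
    rw [integrableExpSet_eq_of_mgf hmgf, integrableExpSet_id_gaussianReal]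
  have := Measure.ext_of_complexMGF_eq hD aemeasurable_id (funext fun z =>
    eqOn_complexMGF_of_mgf hmgf (by simp [hset]))
  rwa [Measure.map_id] at this

lemma gaussianReal_real_Iio_zero (m : ℝ) {s : ℝ} (hs : 0 < s) :
    (gaussianReal m (s ^ 2).toNNReal).real (Set.Iio 0) = stdNormalCDF (-m / s) := by
  have hmap : gaussianReal m (s ^ 2).toNNReal = (gaussianReal 0 1).map fun x => m + s * x := by
    have h1 := gaussianReal_map_const_mul (μ := 0) (v := 1) s
    have h2 := gaussianReal_map_const_add (μ := s * 0) (v := NNReal.mk (s ^ 2) (sq_nonneg s) * 1) m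
    rw [← h1, Measure.map_map (by fun_prop) (by fun_prop)] at h2
    rw [Function.comp_def] at h2
    rw [h2]
    congr 1
    · ring
    · rw [mul_one]; exact Real.toNNReal_of_nonneg (sq_nonneg s)
  have : NullSingletonClass (gaussianReal 0 1) := nullSingletonClass_gaussianReal one_ne_zero
  rw [hmap, map_measureReal_apply (by fun_prop) measurableSet_Iio, stdNormalCDF, cdf_eq_real]
  refine measureReal_congr ?_
  have : (fun x => m + s * x) ⁻¹' Set.Iio 0 = Set.Iio (-m / s) := by
    ext x
    simp only [Set.mem_preimage, Set.mem_Iio]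
    rw [lt_div_iff₀ hs]
    constructor <;> intro h <;> linarith
  rw [this]
  exact Iio_ae_eq_Iic

lemma gaussianReal_real_Ici_zero (m : ℝ) {s : ℝ} (hs : 0 < s) :
    (gaussianReal m (s ^ 2).toNNReal).real (Set.Ici 0) = stdNormalCDF (m / s) := by
  have hv : (s ^ 2).toNNReal ≠ 0 := by simpa using hs.ne'
  have hna : NullSingletonClass (gaussianReal (-m) (s ^ 2).toNNReal) :=
    nullSingletonClass_gaussianReal hv
  rw [← neg_neg m, ← gaussianReal_map_neg, map_measureReal_apply (by fun_prop) measurableSet_Ici,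
    ← gaussianReal_real_Iio_zero _ hs]
  refine measureReal_congr ?_
  have : (fun x : ℝ => -x) ⁻¹' Set.Ici 0 = Set.Iic 0 := by ext x; simp
  rw [this]
  exact Iio_ae_eq_Iic.symm

/-- Change of measure: under the density proportional to `exp U`, the variable `D` is normal with
mean shifted by the covariance `c` of `U` and `D`. -/
lemma integral_indicator_exp_of_gaussian {Ω : Type*} {mΩ : MeasurableSpace Ω} {P : Measure Ω}
    [IsProbabilityMeasure P] {U D : Ω → ℝ} (hD : AEMeasurable D P)
    {mU mD vU vD c : ℝ} (hvD : 0 ≤ vD)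
    (hint : Integrable (fun ω => Real.exp (U ω)) P)
    (h : ∀ z, ∫ ω, Real.exp (U ω + z * D ω) ∂P =
      Real.exp (mU + z * mD + (vU + 2 * z * c + z ^ 2 * vD) / 2))
    {s : Set ℝ} (hs : MeasurableSet s) :
    ∫ ω, s.indicator (fun _ => Real.exp (U ω)) (D ω) ∂P =
      Real.exp (mU + vU / 2) * (gaussianReal (mD + c) vD.toNNReal).real s := by
  have hU : ∫ ω, Real.exp (U ω) ∂P = Real.exp (mU + vU / 2) := by simpa using h 0
  have hpos : Real.exp (mU + vU / 2) ≠ 0 := (Real.exp_pos _).ne'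
  have : IsProbabilityMeasure (P.tilted U) := isProbabilityMeasure_tilted hint
  have hD' : AEMeasurable D (P.tilted U) := hD.mono_ac (tilted_absolutelyContinuous _ _)
  have hlaw : (P.tilted U).map D = gaussianReal (mD + c) vD.toNNReal := by
    refine map_eq_gaussianReal_of_mgf hD' fun z => ?_
    rw [mgf, integral_exp_tilted, hU]
    simp only [Pi.add_apply]
    rw [h z, ← Real.exp_sub, Real.coe_toNNReal _ hvD]
    ring_nf
  rw [← hlaw]
  have h1 : ((P.tilted U).map D).real s = ∫ ω, s.indicator 1 (D ω) ∂(P.tilted U) := by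
    rw [← integral_indicator_one hs,
      integral_map hD' (measurable_one.indicator hs).aestronglyMeasurable]
  rw [h1, integral_tilted, hU, ← integral_const_mul]
  congr 1
  ext ω
  by_cases hω : D ω ∈ s
  · simp only [Set.indicator_of_mem hω, Pi.one_apply, smul_eq_mul, mul_one]
    field_simp
  · simp [Set.indicator_of_notMem hω]

/-- The expectation of `exp (max X₁ X₂)` for a Gaussian pair with non-degenerate difference. -/
lemma integral_exp_max_of_gaussian {Ω : Type*} {mΩ : MeasurableSpace Ω} {P : Measure Ω}
    [IsProbabilityMeasure P] {X₁ X₂ : Ω → ℝ} (h₁ : AEMeasurable X₁ P) (h₂ : AEMeasurable X₂ P)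
    {m₁ m₂ v₁ v₂ c : ℝ} (hv : 0 < v₁ + v₂ - 2 * c)
    (hint : ∀ x y, Integrable (fun ω => Real.exp (x * X₁ ω + y * X₂ ω)) P)
    (h : ∀ x y, ∫ ω, Real.exp (x * X₁ ω + y * X₂ ω) ∂P =
      Real.exp (x * m₁ + y * m₂ + (x ^ 2 * v₁ + 2 * x * y * c + y ^ 2 * v₂) / 2)) :
    ∫ ω, Real.exp (max (X₁ ω) (X₂ ω)) ∂P =
      Real.exp (m₁ + v₁ / 2) * stdNormalCDF ((m₁ - m₂ + v₁ - c) / √(v₁ + v₂ - 2 * c)) +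
      Real.exp (m₂ + v₂ / 2) * stdNormalCDF ((m₂ - m₁ + v₂ - c) / √(v₁ + v₂ - 2 * c)) := by
  have hD : AEMeasurable (fun ω => X₁ ω - X₂ ω) P := h₁.sub h₂
  have hs : 0 < √(v₁ + v₂ - 2 * c) := Real.sqrt_pos.2 hv
  have hsq : √(v₁ + v₂ - 2 * c) ^ 2 = v₁ + v₂ - 2 * c := Real.sq_sqrt hv.le
  have hi₁ : Integrable (fun ω => Real.exp (X₁ ω)) P := by simpa using hint 1 0
  have hi₂ : Integrable (fun ω => Real.exp (X₂ ω)) P := by simpa using hint 0 1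
  have e₁ := integral_indicator_exp_of_gaussian (U := X₁) (mU := m₁) (mD := m₁ - m₂) (vU := v₁)
    (c := v₁ - c) hD hv.le hi₁ (fun z => by
      rw [show (fun ω => Real.exp (X₁ ω + z * (X₁ ω - X₂ ω))) =
        fun ω => Real.exp ((1 + z) * X₁ ω + (-z) * X₂ ω) by ext ω; congr 1; ring, h]
      congr 1; ring) (measurableSet_Ici (a := (0 : ℝ)))
  have e₂ := integral_indicator_exp_of_gaussian (U := X₂) (mU := m₂) (mD := m₁ - m₂) (vU := v₂)
    (c := c - v₂) hD hv.le hi₂ (fun z => by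
      rw [show (fun ω => Real.exp (X₂ ω + z * (X₁ ω - X₂ ω))) =
        fun ω => Real.exp (z * X₁ ω + (1 - z) * X₂ ω) by ext ω; congr 1; ring, h]
      congr 1; ring) (measurableSet_Iio (a := (0 : ℝ)))
  rw [← hsq, gaussianReal_real_Ici_zero _ hs] at e₁
  rw [← hsq, gaussianReal_real_Iio_zero _ hs] at e₂
  rw [show m₁ - m₂ + v₁ - c = m₁ - m₂ + (v₁ - c) by ring, ← e₁,
    show m₂ - m₁ + v₂ - c = -(m₁ - m₂ + (c - v₂)) by ring, ← e₂, ← integral_add]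
  · congr 1
    ext ω
    by_cases hω : 0 ≤ X₁ ω - X₂ ω
    · rw [Set.indicator_of_mem (Set.mem_Ici.2 hω), Set.indicator_of_notMem (by simpa using hω),
        add_zero, max_eq_left (by linarith)]
    · rw [Set.indicator_of_notMem (by simpa using hω), zero_add,
        Set.indicator_of_mem (by simpa using hω), max_eq_right (by linarith)]
  · exact hi₁.indicator₀ (hD.nullMeasurableSet_preimage measurableSet_Ici)
  · exact hi₂.indicator₀ (hD.nullMeasurableSet_preimage measurableSet_Iio)

/-! ### Independence of a sub-σ-algebra and conditioning -/

/-- A random vector is independent of a σ-algebra `m` if its characteristic function factors over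
the events of `m`. -/
lemma indepFun_id_of_charFun {Ω E : Type*} {m mΩ : MeasurableSpace Ω} {P : Measure Ω}
    [IsProbabilityMeasure P] (hm : m ≤ mΩ) [NormedAddCommGroup E] [NormedSpace ℝ E]
    [CompleteSpace E] [MeasurableSpace E] [BorelSpace E] [SecondCountableTopology E]
    {U : Ω → E} (hU : AEMeasurable U P)
    (h : ∀ A, MeasurableSet[m] A → ∀ L : StrongDual ℝ E,
      ∫ ω, A.indicator (fun _ => (1 : ℂ)) ω * Complex.exp ((L (U ω) : ℂ) * Complex.I) ∂P =
        P.real A * ∫ ω, Complex.exp ((L (U ω) : ℂ) * Complex.I) ∂P) :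
    @IndepFun Ω Ω E mΩ m _ id U P := by
  refine (@indepFun_iff_measure_inter_preimage_eq_mul Ω Ω E mΩ P id U m _).2 fun A t hA ht => ?_
  have hA' : MeasurableSet A := hm A hA
  have key : (P.restrict A).map U = (P A) • P.map U := by
    have hfin : IsFiniteMeasure ((P A) • P.map U) := Measure.smul_finite _ (measure_ne_top _ _)
    refine Measure.ext_of_charFunDual (funext fun L => ?_)
    rw [charFunDual_apply, charFunDual_apply, integral_map hU.restrict (by fun_prop),
      integral_smul_measure, integral_map hU (by fun_prop), ← integral_indicator hA']
    refine Eq.trans ?_ ((h A hA L).trans ?_)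
    · congr 1
      ext ω
      by_cases hω : ω ∈ A <;> simp [hω]
    · rw [Complex.real_smul]; rfl
  have := congrArg (fun ν => ν t) key
  simp only [Measure.smul_apply, smul_eq_mul] at this
  rw [Measure.map_apply_of_aemeasurable hU.restrict ht, Measure.restrict_apply' hA',
    Measure.map_apply_of_aemeasurable hU ht] at this
  rw [Set.preimage_id, Set.inter_comm]
  exact this

/-- Conditioning a function of `X` and of a vector independent of `X`: the first argument is frozen
and the second one integrated out. -/
lemma condExp_comp_prodMk_of_indepFun {Ω β E : Type*} {mΩ : MeasurableSpace Ω}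
    {mβ : MeasurableSpace β} {P : Measure Ω} [IsProbabilityMeasure P] [MeasurableSpace E]
    [StandardBorelSpace E] [Nonempty E] {X : Ω → β} (hX : Measurable X)
    {U : Ω → E} (hU : AEMeasurable U P) (hind : IndepFun X U P)
    {f : β × E → ℝ} (hf : Measurable f) (hint : Integrable (fun ω => f (X ω, U ω)) P) :
    P[fun ω => f (X ω, U ω) | mβ.comap X] =ᵐ[P] fun ω => ∫ ω', f (X ω, U ω') ∂P := by
  have h1 := condExp_prod_ae_eq_integral_condDistrib hX hU hf.stronglyMeasurable hint
  have h2 : condDistrib U X P =ᵐ[P.map X] Kernel.const β (P.map U) := by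
    refine condDistrib_ae_eq_of_measure_eq_compProd X hU ?_
    rw [Measure.compProd_const]
    exact (indepFun_iff_map_prod_eq_prod_map_map hX.aemeasurable hU).1 hind
  filter_upwards [h1, ae_of_ae_map hX.aemeasurable h2] with ω h1ω h2ω
  rw [h1ω, h2ω, Kernel.const_apply, integral_map hU]
  exact (hf.comp measurable_prodMk_left).aestronglyMeasurable

/-- `condExp_comp_prodMk_of_indepFun` for the identity map onto a sub-σ-algebra `m`. -/
lemma condExp_eq_integral_of_indepFun_id {Ω E : Type*} {m mΩ : MeasurableSpace Ω} {P : Measure Ω}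
    [IsProbabilityMeasure P] (hm : m ≤ mΩ) [MeasurableSpace E] [StandardBorelSpace E] [Nonempty E]
    {U : Ω → E} (hU : AEMeasurable U P) (hind : @IndepFun Ω Ω E mΩ m _ id U P)
    {f : Ω × E → ℝ} (hf : @Measurable _ _ (@Prod.instMeasurableSpace Ω E m _) _ f)
    (hint : Integrable (fun ω => f (ω, U ω)) P) :
    P[fun ω => f (ω, U ω) | m] =ᵐ[P] fun ω => ∫ ω', f (ω, U ω') ∂P := by
  have h := condExp_comp_prodMk_of_indepFun (mβ := m) (X := id) (measurable_id'' hm) hU hind hf hint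
  rwa [MeasurableSpace.comap_id] at h

/-! ### The joint law of the two factors of the last period -/

namespace IsWienerPair

variable {Ω : Type*} {mΩ : MeasurableSpace Ω} {μ : Measure Ω}
  {𝓕 : Filtration ℝ≥0 mΩ} {B₁ B₂ : ℝ≥0 → Ω → ℝ}

lemma hasLaw_weightedPath [IsProbabilityMeasure μ] (h : IsWienerPair μ 𝓕 B₁ B₂) {κ : ℝ}
    (hκ : κ ≠ 0) {s t : ℝ≥0} (hst : s ≤ t) (x y z : ℝ) :
    HasLaw (fun ω => x * weightedPath κ B₁ s t ω + y * (B₁ t ω - B₁ s ω) + z * (B₂ t ω - B₂ s ω))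
      (gaussianReal 0
        (∫ v in (s : ℝ)..t, ((x * loading κ t v + y) ^ 2 + z ^ 2)).toNNReal) μ := by
  have hm : AEMeasurable (fun ω => x * weightedPath κ B₁ s t ω + y * (B₁ t ω - B₁ s ω) +
      z * (B₂ t ω - B₂ s ω)) μ := by
    have := h.measurable₁; have := h.measurable₂; have := h.aemeasurable_weightedPath hκ hst
    fun_prop
  have h0 : 0 ≤ ∫ v in (s : ℝ)..t, ((x * loading κ t v + y) ^ 2 + z ^ 2) :=
    intervalIntegral.integral_nonneg (by exact_mod_cast hst) fun _ _ => by positivity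
  have : IsProbabilityMeasure (μ.map fun ω => x * weightedPath κ B₁ s t ω +
      y * (B₁ t ω - B₁ s ω) + z * (B₂ t ω - B₂ s ω)) := Measure.isProbabilityMeasure_map hm
  refine ⟨hm, Measure.ext_of_charFun (funext fun w => ?_)⟩
  rw [charFun_gaussianReal, charFun_apply, integral_map hm (by fun_prop)]
  have key := h.integral_indicator_cexp_weightedPath hκ hst (w * x) (w * y) (w * z)
    (A := Set.univ) MeasurableSet.univ
  have e : ∫ v in (s : ℝ)..t, ((w * x * loading κ t v + w * y) ^ 2 + (w * z) ^ 2) =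
      w ^ 2 * ∫ v in (s : ℝ)..t, ((x * loading κ t v + y) ^ 2 + z ^ 2) := by
    rw [← intervalIntegral.integral_const_mul]
    congr 1; ext v; ring
  rw [e] at key
  simp only [Set.indicator_univ, one_mul, probReal_univ, Complex.ofReal_one] at key
  refine Eq.trans ?_ (key.trans ?_)
  · congr 1
    ext ω
    simp only [RCLike.inner_apply, conj_trivial]
    congr 3
    ring
  · rw [Real.coe_toNNReal _ h0]
    congr 1
    push_cast
    ring

/-- The Gaussian functionals of the paths after `s` are independent of `𝓕 s`. -/
lemma indepFun_weightedPath [IsProbabilityMeasure μ] (h : IsWienerPair μ 𝓕 B₁ B₂) {κ : ℝ}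
    (hκ : κ ≠ 0) {s t : ℝ≥0} (hst : s ≤ t) :
    @IndepFun Ω Ω (ℝ × ℝ × ℝ) mΩ (𝓕 s) _ id
      (fun ω => (weightedPath κ B₁ s t ω, B₁ t ω - B₁ s ω, B₂ t ω - B₂ s ω)) μ := by
  have hm : AEMeasurable (fun ω => (weightedPath κ B₁ s t ω, B₁ t ω - B₁ s ω,
      B₂ t ω - B₂ s ω)) μ := by
    have := h.measurable₁; have := h.measurable₂; have := h.aemeasurable_weightedPath hκ hst
    fun_prop
  refine indepFun_id_of_charFun (𝓕.le s) hm fun A hA L => ?_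
  have hL : ∀ a b c : ℝ, L (a, b, c) = L (1, 0, 0) * a + L (0, 1, 0) * b + L (0, 0, 1) * c := by
    intro a b c
    have : (a, b, c) = a • ((1, 0, 0) : ℝ × ℝ × ℝ) + b • ((0, 1, 0) : ℝ × ℝ × ℝ) +
        c • ((0, 0, 1) : ℝ × ℝ × ℝ) := by simp
    rw [this, map_add, map_add, map_smul, map_smul, map_smul]
    simp only [smul_eq_mul]
    ring
  have hLU : ∀ ω, L (weightedPath κ B₁ s t ω, B₁ t ω - B₁ s ω, B₂ t ω - B₂ s ω) =
      L (1, 0, 0) * weightedPath κ B₁ s t ω + L (0, 1, 0) * (B₁ t ω - B₁ s ω) +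
        L (0, 0, 1) * (B₂ t ω - B₂ s ω) := fun ω => hL _ _ _
  simp only [hLU]
  have h1 := h.integral_indicator_cexp_weightedPath hκ hst (L (1, 0, 0)) (L (0, 1, 0))
    (L (0, 0, 1)) hA
  have h2 := h.integral_indicator_cexp_weightedPath hκ hst (L (1, 0, 0)) (L (0, 1, 0))
    (L (0, 0, 1)) (A := Set.univ) MeasurableSet.univ
  simp only [Set.indicator_univ, one_mul, probReal_univ, Complex.ofReal_one] at h2
  rw [h1, h2]

/-- Exponential moments of the Gaussian functionals. -/
lemma integrable_exp_weightedPath [IsProbabilityMeasure μ] (h : IsWienerPair μ 𝓕 B₁ B₂) {κ : ℝ}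
    (hκ : κ ≠ 0) {s t : ℝ≥0} (hst : s ≤ t) (x y z : ℝ) :
    Integrable (fun ω => Real.exp (x * weightedPath κ B₁ s t ω + y * (B₁ t ω - B₁ s ω) +
      z * (B₂ t ω - B₂ s ω))) μ := by
  have hlaw := h.hasLaw_weightedPath hκ hst x y z
  have := integrable_exp_mul_gaussianReal (μ := 0)
    (v := (∫ v in (s : ℝ)..t, ((x * loading κ t v + y) ^ 2 + z ^ 2)).toNNReal) 1
  rw [← hlaw.map_eq, integrable_map_measure (by fun_prop) hlaw.aemeasurable] at this
  simpa [Function.comp_def] using this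

end IsWienerPair

namespace IsMarketModel

variable {Ω : Type*} {mΩ : MeasurableSpace Ω} {μ : Measure Ω}
  {𝓕 : Filtration ℝ≥0 mΩ} {p : MarketParams} {r₀ S₀ : ℝ} {B₁ B₂ r S : ℝ≥0 → Ω → ℝ}

lemma aemeasurable_noiseY (h : IsMarketModel μ 𝓕 p r₀ S₀ B₁ B₂ r S) (hκ : p.κ ≠ 0)
    {s t : ℝ≥0} (hst : s ≤ t) : AEMeasurable (noiseY p r s t) μ :=
  (((h.wiener.aemeasurable_weightedPath hκ hst).const_mul p.σr).const_add
    (meanY p ((t : ℝ) - s))).congr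
    ((h.noiseY_ae_eq hκ hst).mono fun _ hω => hω.symm)

lemma measurable_noiseE (h : IsMarketModel μ 𝓕 p r₀ S₀ B₁ B₂ r S) (s t : ℝ≥0) :
    Measurable (noiseE p B₁ B₂ s t) := by
  have := h.wiener.measurable₁; have := h.wiener.measurable₂
  unfold noiseE assetNoise
  fun_prop

lemma noiseE_eq (s t : ℝ≥0) (ω : Ω) : noiseE p B₁ B₂ s t ω = meanE p ((t : ℝ) - s) +
    p.σS * (p.ρ * (B₁ t ω - B₁ s ω) + √(1 - p.ρ ^ 2) * (B₂ t ω - B₂ s ω)) := by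
  simp only [noiseE, assetNoise, meanE]
  ring

/-- Every combination `x Y + y E` is normal. -/
lemma hasLaw_noise [IsProbabilityMeasure μ] (h : IsMarketModel μ 𝓕 p r₀ S₀ B₁ B₂ r S)
    (hκ : p.κ ≠ 0) (hρ : p.ρ ∈ Set.Icc (-1 : ℝ) 1) {s t : ℝ≥0} (hst : s ≤ t) (x y : ℝ) :
    HasLaw (fun ω => x * noiseY p r s t ω + y * noiseE p B₁ B₂ s t ω)
      (gaussianReal (x * meanY p ((t : ℝ) - s) + y * meanE p ((t : ℝ) - s))
        (varYE p ((t : ℝ) - s) x y).toNNReal) μ := by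
  have h1 := gaussianReal_const_add (h.wiener.hasLaw_weightedPath hκ hst (x * p.σr)
    (y * p.σS * p.ρ) (y * p.σS * √(1 - p.ρ ^ 2)))
    (x * meanY p ((t : ℝ) - s) + y * meanE p ((t : ℝ) - s))
  rw [integral_loading_combination p hκ hρ (by exact_mod_cast hst), zero_add] at h1
  refine h1.congr ?_
  filter_upwards [h.noiseY_ae_eq hκ hst] with ω hω
  rw [hω, noiseE_eq]
  ring

lemma integrable_exp_noise [IsProbabilityMeasure μ] (h : IsMarketModel μ 𝓕 p r₀ S₀ B₁ B₂ r S)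
    (hκ : p.κ ≠ 0) (hρ : p.ρ ∈ Set.Icc (-1 : ℝ) 1) {s t : ℝ≥0} (hst : s ≤ t) (x y : ℝ) :
    Integrable (fun ω => Real.exp (x * noiseY p r s t ω + y * noiseE p B₁ B₂ s t ω)) μ := by
  have hlaw := h.hasLaw_noise hκ hρ hst x y
  have := integrable_exp_mul_gaussianReal
    (μ := x * meanY p ((t : ℝ) - s) + y * meanE p ((t : ℝ) - s))
    (v := (varYE p ((t : ℝ) - s) x y).toNNReal) 1
  rw [← hlaw.map_eq, integrable_map_measure (by fun_prop) hlaw.aemeasurable] at this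
  simpa [Function.comp_def] using this

lemma integral_exp_noise [IsProbabilityMeasure μ] (h : IsMarketModel μ 𝓕 p r₀ S₀ B₁ B₂ r S)
    (hκ : p.κ ≠ 0) (hρ : p.ρ ∈ Set.Icc (-1 : ℝ) 1) {s t : ℝ≥0} (hst : s ≤ t) (x y : ℝ) :
    ∫ ω, Real.exp (x * noiseY p r s t ω + y * noiseE p B₁ B₂ s t ω) ∂μ =
      Real.exp (x * meanY p ((t : ℝ) - s) + y * meanE p ((t : ℝ) - s) +
        varYE p ((t : ℝ) - s) x y / 2) := by
  have hst' : (s : ℝ) ≤ t := by exact_mod_cast hst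
  have hv : 0 ≤ varYE p ((t : ℝ) - s) x y := by
    rw [← integral_loading_combination p hκ hρ hst']
    exact intervalIntegral.integral_nonneg hst' fun _ _ => by positivity
  have := mgf_gaussianReal (h.hasLaw_noise hκ hρ hst x y).map_eq 1
  rw [mgf, Real.coe_toNNReal _ hv] at this
  simpa using this

/-- The factors `(Y, E)` of a period are independent of the information at its start. -/
lemma indepFun_noise [IsProbabilityMeasure μ] (h : IsMarketModel μ 𝓕 p r₀ S₀ B₁ B₂ r S)
    (hκ : p.κ ≠ 0) {s t : ℝ≥0} (hst : s ≤ t) :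
    @IndepFun Ω Ω (ℝ × ℝ) mΩ (𝓕 s) _ id
      (fun ω => (noiseY p r s t ω, noiseE p B₁ B₂ s t ω)) μ := by
  have h1 := h.wiener.indepFun_weightedPath hκ hst
  have h2 := h1.comp (φ := fun ω => ω) (ψ := fun u : ℝ × ℝ × ℝ =>
    (meanY p ((t : ℝ) - s) + p.σr * u.1,
      meanE p ((t : ℝ) - s) + p.σS * (p.ρ * u.2.1 + √(1 - p.ρ ^ 2) * u.2.2)))
    (@measurable_id _ (𝓕 s)) (by fun_prop)
  refine h2.congr (Eventually.of_forall fun _ => rfl) ?_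
  filter_upwards [h.noiseY_ae_eq hκ hst] with ω hω
  simp only [Function.comp]
  rw [hω, noiseE_eq]

end IsMarketModel

/-! ### Sums of squares along partitions -/

/-- Adding increments of vanishing size and bounded variation does not change the limit of the sum
of squares. -/
lemma tendsto_sum_sq_add {m : ℕ → ℕ} {x y : ℕ → ℕ → ℝ} {V C : ℝ}
    (hV : Tendsto (fun n => ∑ k ∈ Finset.range (m n), x n k ^ 2) atTop (𝓝 V))
    (hx : ∀ ε : ℝ, 0 < ε → ∀ᶠ n in atTop, ∀ k, |x n k| ≤ ε)
    (hy : ∀ ε : ℝ, 0 < ε → ∀ᶠ n in atTop, ∀ k, |y n k| ≤ ε)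
    (hC : ∀ n, ∑ k ∈ Finset.range (m n), |y n k| ≤ C) :
    Tendsto (fun n => ∑ k ∈ Finset.range (m n), (x n k + y n k) ^ 2) atTop (𝓝 V) := by
  have hC0 : 0 ≤ C := (Finset.sum_nonneg fun _ _ => abs_nonneg _).trans (hC 0)
  have h : Tendsto (fun n => ∑ k ∈ Finset.range (m n), (2 * x n k + y n k) * y n k)
      atTop (𝓝 0) := by
    rw [Metric.tendsto_nhds]
    intro ε hε
    have hδ : 0 < ε / (4 * (C + 1)) := by positivity
    filter_upwards [hx _ hδ, hy _ hδ] with n h1 h2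
    rw [Real.dist_eq, sub_zero]
    calc |∑ k ∈ Finset.range (m n), (2 * x n k + y n k) * y n k|
        ≤ ∑ k ∈ Finset.range (m n), 3 * (ε / (4 * (C + 1))) * |y n k| := by
          refine (Finset.abs_sum_le_sum_abs _ _).trans (Finset.sum_le_sum fun k _ => ?_)
          rw [abs_mul]
          refine mul_le_mul_of_nonneg_right ?_ (abs_nonneg _)
          have := abs_add_le (2 * x n k) (y n k)
          rw [abs_mul, abs_two] at this
          linarith [h1 k, h2 k]
      _ ≤ 3 * (ε / (4 * (C + 1))) * C := by
          rw [← Finset.mul_sum]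
          exact mul_le_mul_of_nonneg_left (hC n) (by positivity)
      _ < ε := by
          rw [show 3 * (ε / (4 * (C + 1))) * C = (3 * C) * ε / (4 * (C + 1)) by ring,
            div_lt_iff₀ (by positivity)]
          nlinarith
  have := hV.add h
  rw [add_zero] at this
  refine this.congr fun n => ?_
  rw [← Finset.sum_add_distrib]
  exact Finset.sum_congr rfl fun k _ => by ring

lemma abs_exp_sub_taylor_two_le {z : ℝ} (hz : |z| ≤ 1) :
    |Real.exp z - 1 - z - z ^ 2 / 2| ≤ |z| ^ 3 := by
  have h := Real.exp_bound hz (n := 3) (by norm_num)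
  simp only [Finset.sum_range_succ, Finset.sum_range_zero, Nat.factorial] at h
  norm_num at h
  rw [show Real.exp z - 1 - z - z ^ 2 / 2 = Real.exp z - (1 + z + z ^ 2 / 2) by ring]
  refine h.trans ?_
  nlinarith [pow_nonneg (abs_nonneg z) 3]

/-- Second order Taylor expansion of `exp` along increments of vanishing size. -/
lemma tendsto_sum_exp_sub_one_sub {m : ℕ → ℕ} {z : ℕ → ℕ → ℝ} {V : ℝ}
    (hV : Tendsto (fun n => ∑ k ∈ Finset.range (m n), z n k ^ 2) atTop (𝓝 V))
    (hz : ∀ ε : ℝ, 0 < ε → ∀ᶠ n in atTop, ∀ k, |z n k| ≤ ε) :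
    Tendsto (fun n => ∑ k ∈ Finset.range (m n), (Real.exp (z n k) - 1 - z n k))
      atTop (𝓝 (V / 2)) := by
  have h : Tendsto (fun n => ∑ k ∈ Finset.range (m n),
      (Real.exp (z n k) - 1 - z n k - z n k ^ 2 / 2)) atTop (𝓝 0) := by
    rw [Metric.tendsto_nhds]
    intro ε hε
    have hV0 : 0 ≤ V := ge_of_tendsto' hV fun n => Finset.sum_nonneg fun _ _ => sq_nonneg _
    have hδ : 0 < min 1 (ε / (2 * (V + 1))) := by positivity
    filter_upwards [hz _ hδ, hV.eventually_lt_const (lt_add_one V)] with n h1 h2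
    rw [Real.dist_eq, sub_zero]
    calc |∑ k ∈ Finset.range (m n), (Real.exp (z n k) - 1 - z n k - z n k ^ 2 / 2)|
        ≤ ∑ k ∈ Finset.range (m n), ε / (2 * (V + 1)) * z n k ^ 2 := by
          refine (Finset.abs_sum_le_sum_abs _ _).trans (Finset.sum_le_sum fun k _ => ?_)
          refine (abs_exp_sub_taylor_two_le ((h1 k).trans (min_le_left _ _))).trans ?_
          rw [pow_succ', ← sq_abs (z n k)]
          exact mul_le_mul_of_nonneg_right ((h1 k).trans (min_le_right _ _)) (sq_nonneg _)
      _ ≤ ε / (2 * (V + 1)) * (V + 1) := by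
          rw [← Finset.mul_sum]
          exact mul_le_mul_of_nonneg_left h2.le (by positivity)
      _ < ε := by
          rw [show ε / (2 * (V + 1)) * (V + 1) = ε / 2 by field_simp]
          linarith
  have := h.add (hV.div_const 2)
  rw [zero_add] at this
  refine this.congr fun n => ?_
  rw [Finset.sum_div, ← Finset.sum_add_distrib]
  exact Finset.sum_congr rfl fun k _ => by ring

lemma uniformGrid_le {s t : ℝ≥0} (hst : s ≤ t) (n k : ℕ) : uniformGrid s t n k ≤ t := by
  rcases le_total k (n + 1) with h | h
  · exact (monotone_uniformGrid s t n h).trans_eq (uniformGrid_of_le hst le_rfl)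
  · rw [uniformGrid_of_le hst h]

/-- The increments of a continuous function along the uniform grids vanish uniformly. -/
lemma eventually_abs_increment_le {f : ℝ≥0 → ℝ} (hf : Continuous f) (t : ℝ≥0) {ε : ℝ}
    (hε : 0 < ε) :
    ∀ᶠ n in atTop, ∀ k, |f (uniformGrid 0 t n (k + 1)) - f (uniformGrid 0 t n k)| ≤ ε := by
  have huc : UniformContinuousOn f (Set.Icc 0 t) :=
    isCompact_Icc.uniformContinuousOn_of_continuous hf.continuousOn
  obtain ⟨δ, hδ, h⟩ := Metric.uniformContinuousOn_iff.1 huc ε hε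
  filter_upwards [eventually_uniformGrid_mesh 0 t hδ] with n hn k
  have hle : (uniformGrid 0 t n k : ℝ) ≤ uniformGrid 0 t n (k + 1) :=
    NNReal.coe_mono (monotone_uniformGrid 0 t n k.le_succ)
  have := h (uniformGrid 0 t n (k + 1)) ⟨zero_le, uniformGrid_le zero_le n _⟩
    (uniformGrid 0 t n k) ⟨zero_le, uniformGrid_le zero_le n _⟩ (by
      rw [NNReal.dist_eq, abs_of_nonneg (by linarith)]
      exact hn k)
  rw [Real.dist_eq] at this
  exact this.le

/-- The pathwise part of Itô's formula for the logarithm. Here `M = J - (L - L 0)` is half of the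
quadratic variation of `L`; being monotone and continuous, it does not contribute to the sum of
squares of `L = L 0 + I + σ N - M`, so that `M = σ² t / 2`. -/
lemma eq_half_sq_mul_of_tendsto {L I N M : ℝ≥0 → ℝ} {σ K : ℝ} {t : ℝ≥0} {V : ℝ}
    (hL : Continuous L) (hN : Continuous N) (hI : Continuous I)
    (hM : ∀ u, M u = I u + σ * N u - (L u - L 0))
    (hIK : ∀ u v, u ≤ v → v ≤ t → |I v - I u| ≤ K * ((v : ℝ) - u))
    {ns : ℕ → ℕ} (hns : StrictMono ns)
    (hmono : ∀ n k, M (uniformGrid 0 t n k) ≤ M (uniformGrid 0 t n (k + 1)))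
    (hexp : Tendsto (fun n => ∑ k ∈ Finset.range (ns n + 1),
      (Real.exp (L (uniformGrid 0 t (ns n) (k + 1)) - L (uniformGrid 0 t (ns n) k)) - 1))
      atTop (𝓝 (I t + σ * N t)))
    (hqv : Tendsto (fun n => ∑ k ∈ Finset.range (ns n + 1),
      (N (uniformGrid 0 t (ns n) (k + 1)) - N (uniformGrid 0 t (ns n) k)) ^ 2) atTop (𝓝 V)) :
    M t = σ ^ 2 * V / 2 := by
  have hMc : Continuous M := by rw [show M = _ from funext hM]; fun_prop
  have hlast : ∀ n, uniformGrid 0 t n (n + 1) = t := fun n => uniformGrid_of_le zero_le le_rfl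
  have hosc : ∀ {f : ℝ≥0 → ℝ}, Continuous f → ∀ ε : ℝ, 0 < ε → ∀ᶠ n in atTop, ∀ k,
      |f (uniformGrid 0 t (ns n) (k + 1)) - f (uniformGrid 0 t (ns n) k)| ≤ ε :=
    fun hf ε hε => hns.tendsto_atTop.eventually (eventually_abs_increment_le hf t hε)
  have hsq : Tendsto (fun n => ∑ k ∈ Finset.range (ns n + 1),
      (L (uniformGrid 0 t (ns n) (k + 1)) - L (uniformGrid 0 t (ns n) k)) ^ 2)
      atTop (𝓝 (σ ^ 2 * V)) := by
    have := tendsto_sum_sq_add (m := fun n => ns n + 1)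
      (x := fun n k => σ * N (uniformGrid 0 t (ns n) (k + 1)) - σ * N (uniformGrid 0 t (ns n) k))
      (y := fun n k => (I (uniformGrid 0 t (ns n) (k + 1)) - M (uniformGrid 0 t (ns n) (k + 1))) -
        (I (uniformGrid 0 t (ns n) k) - M (uniformGrid 0 t (ns n) k)))
      (V := σ ^ 2 * V) (C := K * t + (M t - M 0)) ?_ (hosc (f := fun u => σ * N u) (by fun_prop))
      (hosc (f := fun u => I u - M u) (by fun_prop)) ?_
    · refine this.congr fun n => Finset.sum_congr rfl fun k _ => ?_
      simp only [hM]
      ring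
    · refine (hqv.const_mul (σ ^ 2)).congr fun n => ?_
      rw [Finset.mul_sum]
      exact Finset.sum_congr rfl fun k _ => by ring
    · intro n
      have e1 := Finset.sum_range_sub (fun k => (uniformGrid 0 t (ns n) k : ℝ)) (ns n + 1)
      have e2 := Finset.sum_range_sub (fun k => M (uniformGrid 0 t (ns n) k)) (ns n + 1)
      rw [hlast, uniformGrid_zero] at e1 e2
      rw [← e2, show K * (t : ℝ) = K * ((t : ℝ) - (0 : ℝ≥0)) by simp, ← e1, Finset.mul_sum,
        ← Finset.sum_add_distrib]
      refine Finset.sum_le_sum fun k _ => ?_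
      have h1 := hIK _ _ (monotone_uniformGrid 0 t (ns n) k.le_succ) (uniformGrid_le zero_le _ _)
      have h2 := hmono (ns n) k
      rw [abs_le] at h1 ⊢
      constructor <;> linarith [h1.1, h1.2]
  have hlim := tendsto_sum_exp_sub_one_sub hsq (hosc hL)
  have hlim' : Tendsto (fun n => ∑ k ∈ Finset.range (ns n + 1),
      (Real.exp (L (uniformGrid 0 t (ns n) (k + 1)) - L (uniformGrid 0 t (ns n) k)) - 1 -
        (L (uniformGrid 0 t (ns n) (k + 1)) - L (uniformGrid 0 t (ns n) k)))) atTop (𝓝 (M t)) := by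
    rw [hM]
    refine (hexp.sub_const (L t - L 0)).congr fun n => ?_
    have e := Finset.sum_range_sub (fun k => L (uniformGrid 0 t (ns n) k)) (ns n + 1)
    rw [hlast, uniformGrid_zero] at e
    rw [← e, ← Finset.sum_sub_distrib]
  exact tendsto_nhds_unique hlim' hlim

/-! ### Partitions and quadratic variation -/

lemma isPartitionSeq_uniformGrid (t : ℝ≥0) :
    IsPartitionSeq t (fun n => n + 1) (uniformGrid 0 t) where
  mono := monotone_uniformGrid 0 t
  left := uniformGrid_zero 0 t
  right _ := uniformGrid_of_le zero_le le_rfl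
  mesh _ hε := (eventually_uniformGrid_mesh 0 t hε).mono fun _ h k _ => h k

/-- The uniform grid of `[0, u]` followed by the uniform grid of `[u, v]`. -/
def concatGrid (u v : ℝ≥0) (n k : ℕ) : ℝ≥0 :=
  uniformGrid 0 u n k + (uniformGrid u v n (k - (n + 1)) - u)

lemma le_uniformGrid (s t : ℝ≥0) (n k : ℕ) : s ≤ uniformGrid s t n k :=
  (uniformGrid_zero s t n).symm.le.trans (monotone_uniformGrid s t n (Nat.zero_le k))

lemma monotone_concatGrid (u v : ℝ≥0) (n : ℕ) : Monotone (concatGrid u v n) := fun _ _ hjk =>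
  add_le_add (monotone_uniformGrid 0 u n hjk)
    (tsub_le_tsub_right (monotone_uniformGrid u v n (Nat.sub_le_sub_right hjk _)) _)

lemma concatGrid_of_le {u v : ℝ≥0} {n k : ℕ} (hk : k ≤ n + 1) :
    concatGrid u v n k = uniformGrid 0 u n k := by
  rw [concatGrid, Nat.sub_eq_zero_of_le hk, uniformGrid_zero, tsub_self, add_zero]

lemma concatGrid_of_ge {u v : ℝ≥0} {n k : ℕ} (hk : n + 1 ≤ k) :
    concatGrid u v n k = uniformGrid u v n (k - (n + 1)) := by
  rw [concatGrid, uniformGrid_of_le zero_le hk, add_tsub_cancel_of_le (le_uniformGrid u v n _)]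

lemma eventually_concatGrid_mesh (u v : ℝ≥0) {ε : ℝ} (hε : 0 < ε) :
    ∀ᶠ n in atTop, ∀ k, (concatGrid u v n (k + 1) : ℝ) - concatGrid u v n k < ε := by
  filter_upwards [eventually_uniformGrid_mesh 0 u hε, eventually_uniformGrid_mesh u v hε]
    with n h1 h2 k
  rcases le_or_gt (k + 1) (n + 1) with hk | hk
  · rw [concatGrid_of_le hk, concatGrid_of_le (by lia)]
    exact h1 k
  · rw [concatGrid_of_ge hk.le, concatGrid_of_ge (by lia), show k + 1 - (n + 1) =
      k - (n + 1) + 1 by lia]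
    exact h2 _

lemma isPartitionSeq_concatGrid_left (u v : ℝ≥0) :
    IsPartitionSeq u (fun n => n + 1) (concatGrid u v) where
  mono := monotone_concatGrid u v
  left n := by rw [concatGrid_of_le (Nat.zero_le _), uniformGrid_zero]
  right n := by rw [concatGrid_of_le le_rfl, uniformGrid_of_le zero_le le_rfl]
  mesh _ hε := (eventually_concatGrid_mesh u v hε).mono fun _ h k _ => h k

lemma isPartitionSeq_concatGrid {u v : ℝ≥0} (huv : u ≤ v) :
    IsPartitionSeq v (fun n => (n + 1) + (n + 1)) (concatGrid u v) where
  mono := monotone_concatGrid u v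
  left n := by rw [concatGrid_of_le (Nat.zero_le _), uniformGrid_zero]
  right n := by
    rw [concatGrid_of_ge (Nat.le_add_right _ _), Nat.add_sub_cancel, uniformGrid_of_le huv le_rfl]
  mesh _ hε := (eventually_concatGrid_mesh u v hε).mono fun _ h k _ => h k

namespace IsWienerPair

variable {Ω : Type*} {mΩ : MeasurableSpace Ω} {μ : Measure Ω} [IsProbabilityMeasure μ]
  {𝓕 : Filtration ℝ≥0 mΩ} {B₁ B₂ : ℝ≥0 → Ω → ℝ}

lemma hasLaw_assetNoise_sub (h : IsWienerPair μ 𝓕 B₁ B₂) (p : MarketParams)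
    (hρ : p.ρ ∈ Set.Icc (-1 : ℝ) 1) {s t : ℝ≥0} (hst : s ≤ t) :
    HasLaw (fun ω => assetNoise p B₁ B₂ t ω - assetNoise p B₁ B₂ s ω)
      (gaussianReal 0 (t - s)) μ := by
  have h1 := h.hasLaw_increment hst p.ρ √(1 - p.ρ ^ 2)
  rw [Real.sq_sqrt (by nlinarith [hρ.1, hρ.2]), add_sub_cancel, one_mul, ← NNReal.coe_sub hst,
    Real.toNNReal_coe] at h1
  refine h1.congr (Eventually.of_forall fun ω => ?_)
  simp only [assetNoise]
  ring

/-- The sums of squares of the asset noise converge to the length of the interval. -/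
lemma tendstoInMeasure_sum_sq (h : IsWienerPair μ 𝓕 B₁ B₂) (p : MarketParams)
    (hρ : p.ρ ∈ Set.Icc (-1 : ℝ) 1) (t : ℝ≥0) :
    TendstoInMeasure μ (fun n ω => ∑ k ∈ Finset.range (n + 1),
      (assetNoise p B₁ B₂ (uniformGrid 0 t n (k + 1)) ω -
        assetNoise p B₁ B₂ (uniformGrid 0 t n k) ω) ^ 2) atTop (fun _ => (t : ℝ)) := by
  have hm1 := h.measurable₁; have hm2 := h.measurable₂
  set N := assetNoise p B₁ B₂ with hN
  have hNm : ∀ t, Measurable (N t) := fun t => by rw [hN]; unfold assetNoise; fun_prop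
  have hNa : ∀ s t : ℝ≥0, s ≤ t → Measurable[𝓕 t] (N s) := fun s t hst =>
    (((h.adapted₁ s).mono (𝓕.mono hst) le_rfl).const_mul _).add
      (((h.adapted₂ s).mono (𝓕.mono hst) le_rfl).const_mul _)
  set g := uniformGrid 0 t with hg
  have hmono : ∀ n k, g n k ≤ g n (k + 1) := fun n k => monotone_uniformGrid 0 t n k.le_succ
  -- moments of the increments, by scaling from the standard normal law
  set C := ∫ x, x ^ 4 ∂(gaussianReal 0 1) with hC
  have hC0 : 0 ≤ C := integral_nonneg fun x => by positivity
  have hlaw : ∀ n k, HasLaw (fun ω => N (g n (k + 1)) ω - N (g n k) ω)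
      (gaussianReal 0 (g n (k + 1) - g n k)) μ :=
    fun n k => h.hasLaw_assetNoise_sub p hρ (hmono n k)
  have hLp : ∀ n k, MemLp (fun ω => (N (g n (k + 1)) ω - N (g n k) ω) ^ 2) 2 μ := by
    intro n k
    have h4 : MemLp (fun ω => N (g n (k + 1)) ω - N (g n k) ω) 4 μ := by
      have := memLp_id_gaussianReal (μ := 0) (v := g n (k + 1) - g n k) 4
      rw [← (hlaw n k).map_eq] at this
      exact (memLp_map_measure_iff (by fun_prop) (hlaw n k).aemeasurable).1 this
    rw [memLp_two_iff_integrable_sq (by fun_prop)]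
    have := h4.integrable_norm_pow (by norm_num)
    refine this.congr (Eventually.of_forall fun ω => ?_)
    simp only [Real.norm_eq_abs]
    rw [← pow_mul]
    exact Even.pow_abs (by decide) _
  have hE2 : ∀ n k, ∫ ω, (N (g n (k + 1)) ω - N (g n k) ω) ^ 2 ∂μ =
      (g n (k + 1) : ℝ) - g n k := by
    intro n k
    have h1 := (hlaw n k).variance_eq
    rw [variance_id_gaussianReal, variance_of_integral_eq_zero (hlaw n k).aemeasurable
      (by rw [(hlaw n k).integral_eq, integral_id_gaussianReal]), NNReal.coe_sub (hmono n k)] at h1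
    exact h1
  have hE4 : ∀ n k, ∫ ω, ((N (g n (k + 1)) ω - N (g n k) ω) ^ 2) ^ 2 ∂μ =
      C * ((g n (k + 1) : ℝ) - g n k) ^ 2 := by
    intro n k
    have h0 : (0 : ℝ) ≤ (g n (k + 1) : ℝ) - g n k := sub_nonneg.2 (hmono n k)
    have h1 := (hlaw n k).integral_comp (f := fun x : ℝ => (x ^ 2) ^ 2) (by fun_prop)
    have h2 := gaussianReal_map_const_mul (μ := 0) (v := 1) √((g n (k + 1) : ℝ) - g n k)
    rw [mul_zero, mul_one] at h2
    have h3 : NNReal.mk (√((g n (k + 1) : ℝ) - g n k) ^ 2) (sq_nonneg _) =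
        g n (k + 1) - g n k := by
      ext
      rw [NNReal.coe_mk, Real.sq_sqrt h0, NNReal.coe_sub (hmono n k)]
    rw [h3] at h2
    refine h1.trans ?_
    rw [← h2, integral_map (by fun_prop) (by fun_prop), hC, ← integral_mul_const]
    congr 1
    ext x
    rw [mul_pow, Real.sq_sqrt h0]
    ring
  have hind : ∀ n, Pairwise fun j k => IndepFun
      (fun ω => (N (g n (j + 1)) ω - N (g n j) ω) ^ 2)
      (fun ω => (N (g n (k + 1)) ω - N (g n k) ω) ^ 2) μ := by
    intro n
    have hlt : ∀ j k, j < k → IndepFun (fun ω => (N (g n (j + 1)) ω - N (g n j) ω) ^ 2)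
        (fun ω => (N (g n (k + 1)) ω - N (g n k) ω) ^ 2) μ := by
      intro j k hjk
      have hpast : Measurable[𝓕 (g n k)] fun ω => (N (g n (j + 1)) ω - N (g n j) ω) ^ 2 :=
        ((hNa _ _ (monotone_uniformGrid 0 t n hjk)).sub
          (hNa _ _ (monotone_uniformGrid 0 t n hjk.le))).pow_const 2
      have hi := indep_of_indep_of_le_left (h.indep_past _ _ (hmono n k)).symm hpast.comap_le
      have hi' : IndepFun (fun ω => (N (g n (j + 1)) ω - N (g n j) ω) ^ 2)
          (fun ω => (B₁ (g n (k + 1)) ω - B₁ (g n k) ω, B₂ (g n (k + 1)) ω - B₂ (g n k) ω)) μ :=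
        (IndepFun_iff_Indep _ _ _).2 hi
      have := hi'.comp (φ := fun x : ℝ => x)
        (ψ := fun b : ℝ × ℝ => (p.ρ * b.1 + √(1 - p.ρ ^ 2) * b.2) ^ 2) (by fun_prop) (by fun_prop)
      refine this.congr (Eventually.of_forall fun _ => rfl) (Eventually.of_forall fun ω => ?_)
      simp only [Function.comp, hN, assetNoise]
      ring
    intro j k hjk
    rcases lt_or_gt_of_ne hjk with hlt' | hlt'
    · exact hlt j k hlt'
    · exact (hlt k j hlt').symm
  have hmean : ∀ n,
      ∫ ω, ∑ k ∈ Finset.range (n + 1), (N (g n (k + 1)) ω - N (g n k) ω) ^ 2 ∂μ = t := by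
    intro n
    rw [integral_finsetSum _ fun k _ => (hLp n k).integrable (by norm_num)]
    simp only [hE2]
    rw [Finset.sum_range_sub (fun k => (g n k : ℝ)), hg, uniformGrid_zero,
      uniformGrid_of_le zero_le le_rfl]
    simp
  have hvar : ∀ n, variance (fun ω => ∑ k ∈ Finset.range (n + 1),
      (N (g n (k + 1)) ω - N (g n k) ω) ^ 2) μ ≤ C * t ^ 2 * (1 / ((n : ℝ) + 1)) := by
    intro n
    have hv := IndepFun.variance_sum (s := Finset.range (n + 1)) (fun k _ => hLp n k)
      fun j _ k _ hjk => hind n hjk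
    rw [show (fun ω => ∑ k ∈ Finset.range (n + 1), (N (g n (k + 1)) ω - N (g n k) ω) ^ 2) =
      ∑ k ∈ Finset.range (n + 1), fun ω => (N (g n (k + 1)) ω - N (g n k) ω) ^ 2 by
        ext ω; simp, hv]
    calc _ ≤ ∑ k ∈ Finset.range (n + 1), C * (t * (1 / ((n : ℝ) + 1))) ^ 2 := by
          refine Finset.sum_le_sum fun k _ => ?_
          refine (variance_le_expectation_sq (by fun_prop)).trans ?_
          refine (hE4 n k).le.trans (mul_le_mul_of_nonneg_left ?_ hC0)
          refine pow_le_pow_left₀ (sub_nonneg.2 (NNReal.coe_mono (hmono n k))) ?_ 2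
          simpa using uniformGrid_succ_sub_le 0 t n k
      _ = C * t ^ 2 * (1 / ((n : ℝ) + 1)) := by
          simp only [Finset.sum_const, Finset.card_range, nsmul_eq_mul]
          push_cast
          field_simp
  rw [tendstoInMeasure_iff_norm]
  intro ε hε
  have hlim : Tendsto (fun n : ℕ => ENNReal.ofReal (C * t ^ 2 * (1 / ((n : ℝ) + 1)) / ε ^ 2)) atTop
      (𝓝 0) := by
    have := ((tendsto_one_div_add_atTop_nhds_zero_nat (𝕜 := ℝ)).const_mul
      (C * (t : ℝ) ^ 2)).div_const (ε ^ 2)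
    simpa using ENNReal.tendsto_ofReal this
  refine tendsto_of_tendsto_of_tendsto_of_le_of_le tendsto_const_nhds hlim (fun _ => zero_le)
    fun n => ?_
  have hL2 : MemLp (fun ω => ∑ k ∈ Finset.range (n + 1),
      (N (g n (k + 1)) ω - N (g n k) ω) ^ 2) 2 μ := memLp_finsetSum _ fun k _ => hLp n k
  have := meas_ge_le_variance_div_sq hL2 hε
  rw [hmean n] at this
  refine this.trans (ENNReal.ofReal_le_ofReal ?_)
  exact div_le_div_of_nonneg_right (hvar n) (by positivity)

end IsWienerPair

/-! ### The asset price -/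

namespace IsMarketModel

variable {Ω : Type*} {mΩ : MeasurableSpace Ω} {μ : Measure Ω}
  {𝓕 : Filtration ℝ≥0 mΩ} {p : MarketParams} {r₀ S₀ : ℝ} {B₁ B₂ r S : ℝ≥0 → Ω → ℝ}

lemma inv_mul_sub_eq_exp (h : IsMarketModel μ 𝓕 p r₀ S₀ B₁ B₂ r S) (u v : ℝ≥0) (ω : Ω) :
    (S u ω)⁻¹ * (S v ω - S u ω) = Real.exp (Real.log (S v ω) - Real.log (S u ω)) - 1 := by
  have hu := h.pos_S u ω
  rw [Real.exp_sub, Real.exp_log (h.pos_S v ω), Real.exp_log hu]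
  field_simp

/-- The difference between the stochastic integral of `dS / S` and the logarithmic return is
nondecreasing: its increments are limits of sums of `exp x - 1 - x ≥ 0`. -/
lemma ae_mono_sub_log (h : IsMarketModel μ 𝓕 p r₀ S₀ B₁ B₂ r S) {u v : ℝ≥0} (huv : u ≤ v) :
    ∀ᵐ ω ∂μ, timeIntegral r 0 u ω + p.σS * assetNoise p B₁ B₂ u ω -
        (Real.log (S u ω) - Real.log (S 0 ω)) ≤
      timeIntegral r 0 v ω + p.σS * assetNoise p B₁ B₂ v ω -
        (Real.log (S v ω) - Real.log (S 0 ω)) := by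
  have h1 := h.sde_S u _ _ (isPartitionSeq_concatGrid_left u v)
  have h2 := h.sde_S v _ _ (isPartitionSeq_concatGrid huv)
  obtain ⟨ns, hns, hu⟩ := h1.exists_seq_tendsto_ae
  obtain ⟨ns', hns', hv⟩ := (h2.comp hns.tendsto_atTop).exists_seq_tendsto_ae
  filter_upwards [hu, hv] with ω hu hv
  replace hu := hu.comp hns'.tendsto_atTop
  simp only [h.inv_mul_sub_eq_exp, Function.comp_def] at hu hv
  set g := concatGrid u v with hg
  have hlim := (hv.sub_const (Real.log (S v ω) - Real.log (S 0 ω))).sub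
    (hu.sub_const (Real.log (S u ω) - Real.log (S 0 ω)))
  refine sub_nonneg.1 (ge_of_tendsto' hlim fun n => ?_)
  set m := ns (ns' n)
  have e1 := Finset.sum_range_sub (fun k => Real.log (S (g m k) ω)) (m + 1)
  have e2 := Finset.sum_range_sub (fun k => Real.log (S (g m k) ω)) (m + 1 + (m + 1))
  rw [hg, (isPartitionSeq_concatGrid_left u v).right m,
    (isPartitionSeq_concatGrid_left u v).left m, ← hg] at e1
  rw [hg, (isPartitionSeq_concatGrid huv).right m,
    (isPartitionSeq_concatGrid huv).left m, ← hg] at e2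
  rw [← e1, ← e2, ← Finset.sum_sub_distrib, ← Finset.sum_sub_distrib, sub_nonneg]
  refine Finset.sum_le_sum_of_subset_of_nonneg
    (Finset.range_subset_range.2 (Nat.le_add_right _ _)) fun k _ _ => ?_
  have := Real.add_one_le_exp (Real.log (S (g m (k + 1)) ω) - Real.log (S (g m k) ω))
  linarith

/-- The explicit solution of the asset price equation. -/
lemma ae_log_sub_log_zero [IsProbabilityMeasure μ] (h : IsMarketModel μ 𝓕 p r₀ S₀ B₁ B₂ r S)
    (hρ : p.ρ ∈ Set.Icc (-1 : ℝ) 1) (t : ℝ≥0) :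
    ∀ᵐ ω ∂μ, Real.log (S t ω) - Real.log (S 0 ω) = timeIntegral r 0 t ω +
      p.σS * assetNoise p B₁ B₂ t ω - p.σS ^ 2 * t / 2 := by
  obtain ⟨ns, hns, hqv⟩ := (h.wiener.tendstoInMeasure_sum_sq p hρ t).exists_seq_tendsto_ae
  obtain ⟨ns', hns', hS⟩ := ((h.sde_S t _ _ (isPartitionSeq_uniformGrid t)).comp
    hns.tendsto_atTop).exists_seq_tendsto_ae
  have hmono : ∀ᵐ ω ∂μ, ∀ n k : ℕ, _ := ae_all_iff.2 fun n => ae_all_iff.2 fun k =>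
    h.ae_mono_sub_log (monotone_uniformGrid 0 t n k.le_succ)
  filter_upwards [hqv, hS, hmono, h.wiener.brownian₁.cont, h.wiener.brownian₂.cont]
    with ω hqv hS hmono hB1 hB2
  simp only [h.inv_mul_sub_eq_exp, Function.comp_def] at hS
  have hrc := h.continuous_rate ω
  have hI : ∀ x y : ℝ, IntervalIntegrable (fun v : ℝ => r v.toNNReal ω) volume x y :=
    fun x y => hrc.intervalIntegrable x y
  obtain ⟨K, hK⟩ := isCompact_Icc.exists_bound_of_continuousOn (s := Set.Icc (0 : ℝ) t)
    hrc.continuousOn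
  have hM := eq_half_sq_mul_of_tendsto (L := fun u => Real.log (S u ω))
    (I := fun u => timeIntegral r 0 u ω) (N := fun u => assetNoise p B₁ B₂ u ω)
    (M := fun u => timeIntegral r 0 u ω + p.σS * assetNoise p B₁ B₂ u ω -
        (Real.log (S u ω) - Real.log (S 0 ω))) (σ := p.σS) (K := K) (t := t) (V := t)
    ((h.continuous_S ω).log fun u => (h.pos_S u ω).ne')
    (by unfold assetNoise; fun_prop)
    ((intervalIntegral.continuous_primitive hI (0 : ℝ≥0)).comp NNReal.continuous_coe)
    (fun u => rfl) ?_ (hns.comp hns') hmono hS (hqv.comp hns'.tendsto_atTop)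
  · linarith
  · intro u v huv hvt
    have huv' : (u : ℝ) ≤ v := by exact_mod_cast huv
    have e : timeIntegral r 0 v ω - timeIntegral r 0 u ω = ∫ x in (u : ℝ)..v, r x.toNNReal ω :=
      intervalIntegral.integral_interval_sub_left (hI _ _) (hI _ _)
    rw [e, ← abs_of_nonneg (sub_nonneg.2 huv'), ← Real.norm_eq_abs]
    refine intervalIntegral.norm_integral_le_of_norm_le_const fun x hx => ?_
    rw [Set.uIoc_of_le huv'] at hx
    exact hK x ⟨u.2.trans hx.1.le, hx.2.trans (by exact_mod_cast hvt)⟩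

/-- The return over a period: `S(t) / S(s) = exp (∫_s^t r + E)`. -/
lemma ae_div_eq_exp [IsProbabilityMeasure μ] (h : IsMarketModel μ 𝓕 p r₀ S₀ B₁ B₂ r S)
    (hρ : p.ρ ∈ Set.Icc (-1 : ℝ) 1) (s t : ℝ≥0) :
    ∀ᵐ ω ∂μ, S t ω / S s ω = Real.exp (timeIntegral r s t ω + noiseE p B₁ B₂ s t ω) := by
  filter_upwards [h.ae_log_sub_log_zero hρ s, h.ae_log_sub_log_zero hρ t] with ω hs ht
  have hI : ∀ x y : ℝ, IntervalIntegrable (fun v : ℝ => r v.toNNReal ω) volume x y :=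
    fun x y => (h.continuous_rate ω).intervalIntegrable x y
  have hadd : timeIntegral r 0 s ω + timeIntegral r s t ω = timeIntegral r 0 t ω :=
    intervalIntegral.integral_add_adjacent_intervals (hI _ _) (hI _ _)
  rw [← Real.exp_log (h.pos_S t ω), ← Real.exp_log (h.pos_S s ω), ← Real.exp_sub]
  congr 1
  rw [noiseE]
  linarith

end IsMarketModel

/-! ### Closed-form expectations -/

lemma sigma₁_radicand_eq (p : MarketParams) (hκ : p.κ ≠ 0) (hσr : 0 < p.σr) (hσS : 0 < p.σS)
    (hρ : p.ρ ∈ Set.Icc (-1 : ℝ) 1) {Δ : ℝ} (hΔ : 0 < Δ) (ℓ : ℝ) :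
    (1 - ℓ) ^ 2 * sdY p Δ ^ 2 + sdE p Δ ^ 2 + 2 * (1 - ℓ) * corrYE p Δ * sdY p Δ * sdE p Δ =
      varYE p Δ (1 - ℓ) 1 := by
  rw [varYE, ← corrYE_mul p hκ hσr hσS hρ hΔ]
  ring

lemma sigma₁_sq (p : MarketParams) (hκ : p.κ ≠ 0) (hσr : 0 < p.σr) (hσS : 0 < p.σS)
    (hρ : p.ρ ∈ Set.Icc (-1 : ℝ) 1) {Δ : ℝ} (hΔ : 0 < Δ) (ℓ : ℝ) :
    σ₁ p ℓ Δ ^ 2 = varYE p Δ (1 - ℓ) 1 := by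
  rw [σ₁, sigma₁_radicand_eq p hκ hσr hσS hρ hΔ,
    Real.sq_sqrt (varYE_pos p hκ hσr hσS hρ hΔ _).le]

/-- The covariance of `(1 - ℓ) Y + E` and `-ℓ Y`; the division by `σ₁ > 0` in `ρ₁₂` cancels. -/
lemma rho₁₂_mul (p : MarketParams) (hκ : p.κ ≠ 0) (hσr : 0 < p.σr) (hσS : 0 < p.σS)
    (hρ : p.ρ ∈ Set.Icc (-1 : ℝ) 1) {Δ : ℝ} (hΔ : 0 < Δ) (ℓ : ℝ) :
    ρ₁₂ p ℓ Δ * σ₁ p ℓ Δ * σ₂ p ℓ Δ = -ℓ * ((1 - ℓ) * sdY p Δ ^ 2 + covYE p Δ) := by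
  have h := Real.sqrt_pos.2 (varYE_pos p hκ hσr hσS hρ hΔ (1 - ℓ))
  rw [ρ₁₂, σ₁, sigma₁_radicand_eq p hκ hσr hσS hρ hΔ, div_mul_cancel₀ _ h.ne', σ₂,
    ← corrYE_mul p hκ hσr hσS hρ hΔ]
  ring

lemma cashflow_nonneg {β G x : ℝ} (hβ : β ∈ Set.Icc (0 : ℝ) 1) (hG : 0 ≤ G) (hx : 0 ≤ x) :
    0 ≤ cashflow β G x := by
  unfold cashflow
  split_ifs with h
  · exact hx
  · have := mul_nonneg (sub_nonneg.2 hβ.2) (sub_nonneg.2 (not_le.1 h).le)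
    linarith

lemma cashflow_le {β G x : ℝ} (hβ : β ∈ Set.Icc (0 : ℝ) 1) : cashflow β G x ≤ x := by
  unfold cashflow
  split_ifs with h
  · exact le_rfl
  · nlinarith [mul_nonneg hβ.1 (sub_nonneg.2 (not_le.1 h).le)]

lemma measurable_cashflow (β G : ℝ) : Measurable (cashflow β G) :=
  Measurable.ite measurableSet_Iic measurable_id (by fun_prop)

lemma exp_mul_max_eq_exp_max {b c ℓ y e : ℝ} (hb : 0 < b) (hc : 0 < c) :
    Real.exp (-ℓ * y) * max (b * Real.exp (y + e)) c =
      Real.exp (max (Real.log b + (1 - ℓ) * y + e) (Real.log c - ℓ * y)) := by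
  rw [Real.exp_monotone.map_max, mul_max_of_nonneg _ _ (Real.exp_pos _).le]
  congr 1
  · rw [show Real.log b + (1 - ℓ) * y + e = Real.log b + ((-ℓ * y) + (y + e)) by ring,
      Real.exp_add (Real.log b), Real.exp_log hb, Real.exp_add (-ℓ * y)]
    ring
  · rw [show Real.log c - ℓ * y = Real.log c + -ℓ * y by ring, Real.exp_add, Real.exp_log hc]
    ring

namespace IsMarketModel

variable {Ω : Type*} {mΩ : MeasurableSpace Ω} {μ : Measure Ω} [IsProbabilityMeasure μ]
  {𝓕 : Filtration ℝ≥0 mΩ} {p : MarketParams} {r₀ S₀ : ℝ} {B₁ B₂ r S : ℝ≥0 → Ω → ℝ}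

lemma integral_payoff_of_b_eq_zero (h : IsMarketModel μ 𝓕 p r₀ S₀ B₁ B₂ r S)
    (hκ : p.κ ≠ 0) (hρ : p.ρ ∈ Set.Icc (-1 : ℝ) 1) {s t : ℝ≥0} (hst : s ≤ t) (ℓ : ℝ) {c : ℝ}
    (hc : 0 ≤ c) :
    ∫ ω, Real.exp (-ℓ * noiseY p r s t ω) *
      max (0 * Real.exp (noiseY p r s t ω + noiseE p B₁ B₂ s t ω)) c ∂μ =
      c * Real.exp (-ℓ * meanY p ((t : ℝ) - s) + ℓ ^ 2 * sdY p ((t : ℝ) - s) ^ 2 / 2) := by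
  have h1 := h.integral_exp_noise hκ hρ hst (-ℓ) 0
  simp only [zero_mul, add_zero] at h1
  simp only [zero_mul, max_eq_right hc]
  rw [integral_mul_const, h1, mul_comm]
  congr 2
  rw [varYE]
  ring

lemma integral_payoff_of_c_eq_zero (h : IsMarketModel μ 𝓕 p r₀ S₀ B₁ B₂ r S)
    (hκ : p.κ ≠ 0) (hσr : 0 < p.σr) (hσS : 0 < p.σS) (hρ : p.ρ ∈ Set.Icc (-1 : ℝ) 1)
    {s t : ℝ≥0} (hst : s < t) (ℓ : ℝ) {b : ℝ} (hb : 0 ≤ b) :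
    ∫ ω, Real.exp (-ℓ * noiseY p r s t ω) *
      max (b * Real.exp (noiseY p r s t ω + noiseE p B₁ B₂ s t ω)) 0 ∂μ =
      b * Real.exp ((1 - ℓ) * meanY p ((t : ℝ) - s) + meanE p ((t : ℝ) - s) +
        ((1 - ℓ) ^ 2 * sdY p ((t : ℝ) - s) ^ 2 + sdE p ((t : ℝ) - s) ^ 2 +
          2 * (1 - ℓ) * corrYE p ((t : ℝ) - s) * sdY p ((t : ℝ) - s) *
            sdE p ((t : ℝ) - s)) / 2) := by
  have hΔ : 0 < (t : ℝ) - s := sub_pos.2 (by exact_mod_cast hst)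
  have h1 := h.integral_exp_noise hκ hρ hst.le (1 - ℓ) 1
  simp only [one_mul] at h1
  rw [sigma₁_radicand_eq p hκ hσr hσS hρ hΔ, ← h1, ← integral_const_mul]
  congr 1
  ext ω
  rw [max_eq_left (by positivity), mul_left_comm, ← Real.exp_add]
  congr 2
  ring

lemma integral_payoff_of_pos (h : IsMarketModel μ 𝓕 p r₀ S₀ B₁ B₂ r S)
    (hκ : p.κ ≠ 0) (hσr : 0 < p.σr) (hσS : 0 < p.σS) (hρ : p.ρ ∈ Set.Icc (-1 : ℝ) 1)
    {s t : ℝ≥0} (hst : s < t) (ℓ a b c : ℝ) :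
    a * ∫ ω, Real.exp (max (Real.log b + (1 - ℓ) * noiseY p r s t ω + noiseE p B₁ B₂ s t ω)
      (Real.log c - ℓ * noiseY p r s t ω)) ∂μ = valuePos p ℓ ((t : ℝ) - s) a b c := by
  have hΔ : 0 < (t : ℝ) - s := sub_pos.2 (by exact_mod_cast hst)
  have hY := h.aemeasurable_noiseY hκ hst.le
  have hE := h.measurable_noiseE s t
  set Δ := (t : ℝ) - s with hΔdef
  have hrew : ∀ x y ω, x * (Real.log b + (1 - ℓ) * noiseY p r s t ω + noiseE p B₁ B₂ s t ω) +
      y * (Real.log c - ℓ * noiseY p r s t ω) = (x * Real.log b + y * Real.log c) +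
        ((x * (1 - ℓ) - y * ℓ) * noiseY p r s t ω + x * noiseE p B₁ B₂ s t ω) :=
    fun x y ω => by ring
  have hvar : varYE p Δ 1 1 = varYE p Δ (1 - ℓ) 1 + (σ₂ p ℓ Δ) ^ 2 -
      2 * (-ℓ * ((1 - ℓ) * sdY p Δ ^ 2 + covYE p Δ)) := by
    simp only [varYE, σ₂]
    ring
  have key := integral_exp_max_of_gaussian (P := μ)
    (X₁ := fun ω => Real.log b + (1 - ℓ) * noiseY p r s t ω + noiseE p B₁ B₂ s t ω)
    (X₂ := fun ω => Real.log c - ℓ * noiseY p r s t ω)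
    (m₁ := m₁ p ℓ Δ b) (m₂ := m₂ p ℓ Δ c) (v₁ := varYE p Δ (1 - ℓ) 1) (v₂ := σ₂ p ℓ Δ ^ 2)
    (c := -ℓ * ((1 - ℓ) * sdY p Δ ^ 2 + covYE p Δ)) (by fun_prop) (by fun_prop)
    (hvar ▸ varYE_pos p hκ hσr hσS hρ hΔ 1) (fun x y => by
      simp only [hrew, Real.exp_add (x * Real.log b + y * Real.log c)]
      exact (h.integrable_exp_noise hκ hρ hst.le _ _).const_mul _) (fun x y => by
      simp only [hrew, Real.exp_add (x * Real.log b + y * Real.log c)]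
      rw [integral_const_mul, h.integral_exp_noise hκ hρ hst.le, ← Real.exp_add]
      congr 1
      simp only [m₁, m₂, varYE, σ₂, ← hΔdef]
      ring)
  rw [key, valuePos, rho₁₂_mul p hκ hσr hσS hρ hΔ, sigma₁_sq p hκ hσr hσS hρ hΔ,
    mul_assoc 2 (ρ₁₂ p ℓ Δ), mul_assoc 2, rho₁₂_mul p hκ hσr hσS hρ hΔ]
  ring

/-! ### Integrability of the payoff -/

/-- Exponential moments of the short rate, its time integral and the asset noise up to time `s`. -/
lemma integrable_exp_state (h : IsMarketModel μ 𝓕 p r₀ S₀ B₁ B₂ r S) (hκ : p.κ ≠ 0)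
    (s : ℝ≥0) (x y z : ℝ) :
    Integrable (fun ω => Real.exp (x * r s ω + y * timeIntegral r 0 s ω +
      z * noiseE p B₁ B₂ 0 s ω)) μ := by
  have hi := (h.wiener.integrable_exp_weightedPath hκ (zero_le (a := s)) ((y - x * p.κ) * p.σr)
    (x * p.σr + z * p.σS * p.ρ) (z * p.σS * √(1 - p.ρ ^ 2))).const_mul
    (Real.exp (x * (r₀ + p.κ * p.θ * s) + (y - x * p.κ) *
      (rateLoading p s * r₀ + meanY p s) + z * meanE p s))
  refine hi.congr ?_
  filter_upwards [h.noiseY_ae_eq hκ (zero_le (a := s)), h.ae_rate_eq, h.sde_r,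
    h.wiener.brownian₁.eval_zero_ae_eq_zero] with ω hY hr h0 hB
  have e0 : r 0 ω = r₀ := by
    have := h0 0
    rw [hB] at this
    simpa [timeIntegral] using this
  have e1 := hr 0 s
  have e2 := h.timeIntegral_eq_add_noiseY hκ (zero_le (a := s)) ω
  rw [hY, e0] at e2
  rw [e0] at e1
  rw [← Real.exp_add, noiseE_eq, e1, e2]
  simp only [NNReal.coe_zero, sub_zero]
  congr 1
  ring

end IsMarketModel

/-! ### The contract -/

section Contract

variable {Ω : Type*} {mΩ : MeasurableSpace Ω} {μ : Measure Ω} {𝓕 : Filtration ℝ≥0 mΩ}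
  {W₀ α : ℝ} {t : ℕ → ℝ≥0} {N : ℕ} {π : ℕ → Ω → ℝ} {S : ℝ≥0 → Ω → ℝ}

lemma IsAdmissible.guaranteeAccount_bounds (hπ : IsAdmissible μ 𝓕 W₀ t N π) (hW₀ : 0 ≤ W₀)
    {n : ℕ} (hn : n ≤ N) :
    ∀ᵐ ω ∂μ, 0 ≤ guaranteeAccount W₀ π n ω ∧ guaranteeAccount W₀ π n ω ≤ W₀ := by
  induction n with
  | zero => exact Eventually.of_forall fun ω => ⟨hW₀, le_rfl⟩
  | succ n ih =>
    filter_upwards [ih (by lia), (hπ n (by lia)).2] with ω h1 h2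
    simp only [guaranteeAccount]
    constructor <;> linarith [h1.2, h2.1, h2.2]

lemma IsAdmissible.measurable_guaranteeAccount (hπ : IsAdmissible μ 𝓕 W₀ t N π) {s : ℝ≥0}
    {n : ℕ} (hn : n ≤ N) (hs : ∀ k < n, t k ≤ s) :
    Measurable[𝓕 s] (guaranteeAccount W₀ π n) := by
  induction n with
  | zero => exact measurable_const
  | succ n ih =>
    exact (ih (by lia) fun k hk => hs k (by lia)).sub
      ((hπ n (by lia)).1.mono (𝓕.mono (hs n (by lia))) le_rfl)

lemma IsAdmissible.measurable_wealthAccount (hπ : IsAdmissible μ 𝓕 W₀ t N π)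
    (hS : Adapted 𝓕 S) {s : ℝ≥0} {n : ℕ} (hn : n ≤ N) (hs : ∀ k ≤ n, t k ≤ s) :
    Measurable[𝓕 s] (wealthAccount W₀ α t S π n) := by
  induction n with
  | zero => exact measurable_const
  | succ n ih =>
    have hSm : ∀ k ≤ n + 1, Measurable[𝓕 s] (S (t k)) := fun k hk =>
      (hS (t k)).mono (𝓕.mono (hs k hk)) le_rfl
    have h1 := (ih (by lia) fun k hk => hs k (by lia)).sub
      ((hπ n (by lia)).1.mono (𝓕.mono (hs n (by lia))) le_rfl)
    exact ((h1.max measurable_const).mul ((hSm _ le_rfl).div (hSm n (by lia)))).mul_const _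

/-- The wealth account is dominated by the account without withdrawals. -/
lemma IsAdmissible.wealthAccount_bounds (hπ : IsAdmissible μ 𝓕 W₀ t N π) (hW₀ : 0 ≤ W₀)
    (ht₀ : t 0 = 0) (hS : ∀ u ω, 0 < S u ω) {n : ℕ} (hn : n ≤ N) :
    ∀ᵐ ω ∂μ, 0 ≤ wealthAccount W₀ α t S π n ω ∧
      wealthAccount W₀ α t S π n ω ≤ W₀ * (S (t n) ω / S 0 ω) * Real.exp (-α * t n) := by
  induction n with
  | zero =>
    refine Eventually.of_forall fun ω => ⟨hW₀, ?_⟩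
    simp [wealthAccount, ht₀, (hS 0 ω).ne']
  | succ n ih =>
    filter_upwards [ih (by lia), (hπ n (by lia)).2] with ω h1 h2
    have hq : 0 < S (t (n + 1)) ω / S (t n) ω := div_pos (hS _ _) (hS _ _)
    simp only [wealthAccount]
    refine ⟨by positivity, ?_⟩
    have h3 : max (wealthAccount W₀ α t S π n ω - π n ω) 0 ≤
        W₀ * (S (t n) ω / S 0 ω) * Real.exp (-α * t n) :=
      (max_le (by linarith [h2.1]) h1.1).trans h1.2
    calc _ ≤ W₀ * (S (t n) ω / S 0 ω) * Real.exp (-α * t n) *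
          (S (t (n + 1)) ω / S (t n) ω) * Real.exp (-α * ((t (n + 1) : ℝ) - t n)) := by gcongr
      _ = _ := by
        have h4 := (hS (t n) ω).ne'
        have h5 := (hS 0 ω).ne'
        rw [show -α * (t (n + 1) : ℝ) = -α * t n + -α * ((t (n + 1) : ℝ) - t n) by ring,
          Real.exp_add]
        field_simp

end Contract

/-! ### Valuation over the last period -/

section LastPeriod

variable {Ω : Type*} {mΩ : MeasurableSpace Ω} {μ : Measure Ω}
  {𝓕 : Filtration ℝ≥0 mΩ} {p : MarketParams} {r₀ S₀ : ℝ} {B₁ B₂ r S : ℝ≥0 → Ω → ℝ}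
  {M : ℕ} {t : ℕ → ℝ≥0} {W₀ α β ℓ : ℝ} {π : ℕ → Ω → ℝ}

/-- The discounted payoff in terms of the state `a`, `b`, `c` at the start of the last period and
the factors `Y`, `E` of that period. -/
lemma IsMarketModel.discountedPayoff_ae_eq [IsProbabilityMeasure μ]
    (h : IsMarketModel μ 𝓕 p r₀ S₀ B₁ B₂ r S)
    (hκ : p.κ ≠ 0) (hρ : p.ρ ∈ Set.Icc (-1 : ℝ) 1) (hst : t M ≤ t (M + 1)) :
    discountedPayoff W₀ α β ℓ t (M + 1) r S π =ᵐ[μ] fun ω =>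
      coeffA p ℓ t (M + 1) r ω * (Real.exp (-ℓ * noiseY p r (t M) (t (M + 1)) ω) *
        max (coeffB p W₀ α t (M + 1) r S π ω * Real.exp (noiseY p r (t M) (t (M + 1)) ω +
          noiseE p B₁ B₂ (t M) (t (M + 1)) ω)) (finalGuarantee W₀ β t (M + 1) π ω)) := by
  filter_upwards [h.ae_div_eq_exp hρ (t M) (t (M + 1))] with ω hω
  have e := h.timeIntegral_eq_add_noiseY hκ hst ω
  simp only [discountedPayoff, wealthAccount, coeffA, coeffB, Nat.add_sub_cancel]
  rw [hω, ← mul_assoc, e, ← Real.exp_add]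
  congr 1
  · congr 1; ring
  · congr 1
    rw [add_assoc, Real.exp_add (rateLoading p _ * _)]
    ring

lemma IsAdmissible.finalGuarantee_bounds (hπ : IsAdmissible μ 𝓕 W₀ t (M + 1) π) (hW₀ : 0 ≤ W₀)
    (hβ : β ∈ Set.Icc (0 : ℝ) 1) (hst : t M ≤ t (M + 1)) :
    ∀ᵐ ω ∂μ, 0 ≤ finalGuarantee W₀ β t (M + 1) π ω ∧
      finalGuarantee W₀ β t (M + 1) π ω ≤ W₀ := by
  have hG : 0 ≤ contractualFinal W₀ t (M + 1) := by
    have : (t M : ℝ) ≤ t (M + 1) := by exact_mod_cast hst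
    exact div_nonneg (mul_nonneg hW₀ (sub_nonneg.2 this)) (t (M + 1)).2
  filter_upwards [hπ.guaranteeAccount_bounds hW₀ le_rfl] with ω hω
  exact ⟨cashflow_nonneg hβ hG hω.1, (cashflow_le hβ).trans hω.2⟩

lemma coeffB_nonneg (ω : Ω) : 0 ≤ coeffB p W₀ α t (M + 1) r S π ω := by
  unfold coeffB; positivity

/-- Integrability of the payoff, written in terms of the state and the factors: it is dominated by
exponentials of Gaussian variables. -/
lemma IsMarketModel.integrable_payoff [IsProbabilityMeasure μ]
    (h : IsMarketModel μ 𝓕 p r₀ S₀ B₁ B₂ r S)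
    (hκ : p.κ ≠ 0) (hρ : p.ρ ∈ Set.Icc (-1 : ℝ) 1) (ht₀ : t 0 = 0) (hst : t M ≤ t (M + 1))
    (hW₀ : 0 ≤ W₀) (hβ : β ∈ Set.Icc (0 : ℝ) 1) (hπ : IsAdmissible μ 𝓕 W₀ t (M + 1) π)
    (ha : Measurable (coeffA p ℓ t (M + 1) r)) (hb : Measurable (coeffB p W₀ α t (M + 1) r S π))
    (hc : Measurable (finalGuarantee W₀ β t (M + 1) π)) :
    Integrable (fun ω => coeffA p ℓ t (M + 1) r ω *
      (Real.exp (-ℓ * noiseY p r (t M) (t (M + 1)) ω) *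
        max (coeffB p W₀ α t (M + 1) r S π ω * Real.exp (noiseY p r (t M) (t (M + 1)) ω +
          noiseE p B₁ B₂ (t M) (t (M + 1)) ω)) (finalGuarantee W₀ β t (M + 1) π ω))) μ := by
  have hY := h.aemeasurable_noiseY hκ hst
  have hE := h.measurable_noiseE (t M) (t (M + 1))
  set Δ := (t (M + 1) : ℝ) - t M with hΔ
  set l := rateLoading p Δ with hl
  set Y := noiseY p r (t M) (t (M + 1)) with hYdef
  set E := noiseE p B₁ B₂ (t M) (t (M + 1)) with hEdef
  have i1 := h.integrable_exp_state hκ (t M) (2 * ((1 - ℓ) * l)) 2 2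
  have i2 := h.integrable_exp_noise hκ hρ hst (2 * (1 - ℓ)) 2
  have i3 := h.integrable_exp_state hκ (t M) (2 * (-ℓ * l)) 0 0
  have i4 := h.integrable_exp_noise hκ hρ hst (2 * (-ℓ)) 0
  have hdom := ((i1.add i2).const_mul (W₀ * Real.exp (-α * t M) * Real.exp (-α * Δ))).add
    ((i3.add i4).const_mul W₀)
  -- `exp (x + y) ≤ exp (2 x) + exp (2 y)` separates the past from the last period
  have hexp : ∀ x y : ℝ, Real.exp (x + y) ≤ Real.exp (2 * x) + Real.exp (2 * y) := by
    intro x y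
    have e1 : Real.exp (2 * x) = Real.exp x ^ 2 := by rw [← Real.exp_nat_mul]; norm_num
    have e2 : Real.exp (2 * y) = Real.exp y ^ 2 := by rw [← Real.exp_nat_mul]; norm_num
    rw [Real.exp_add, e1, e2]
    nlinarith [sq_nonneg (Real.exp x - Real.exp y), sq_nonneg (Real.exp x),
      sq_nonneg (Real.exp y)]
  refine hdom.mono' (AEMeasurable.aestronglyMeasurable (by fun_prop)) ?_
  filter_upwards [hπ.wealthAccount_bounds (α := α) hW₀ ht₀ h.pos_S (Nat.le_succ M),
    (hπ M (Nat.lt_succ_self M)).2, hπ.finalGuarantee_bounds hW₀ hβ hst,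
    h.ae_div_eq_exp hρ 0 (t M)] with ω hW hπω hcω hS
  have hb0 := coeffB_nonneg (p := p) (W₀ := W₀) (α := α) (t := t) (M := M) (r := r) (S := S)
    (π := π) ω
  have ha0 : 0 < coeffA p ℓ t (M + 1) r ω := Real.exp_pos _
  have hmax : max (wealthAccount W₀ α t S π M ω - π M ω) 0 ≤
      W₀ * Real.exp (timeIntegral r 0 (t M) ω + noiseE p B₁ B₂ 0 (t M) ω) *
        Real.exp (-α * t M) := by
    rw [← hS]
    exact (max_le (by linarith [hπω.1]) hW.1).trans hW.2
  have hbound : coeffB p W₀ α t (M + 1) r S π ω ≤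
      W₀ * Real.exp (timeIntegral r 0 (t M) ω + noiseE p B₁ B₂ 0 (t M) ω) *
        Real.exp (-α * t M) * Real.exp (-α * Δ) * Real.exp (l * r (t M) ω) := by
    unfold coeffB
    simp only [Nat.add_sub_cancel]
    gcongr
  have hle : max (coeffB p W₀ α t (M + 1) r S π ω * Real.exp (Y ω + E ω))
      (finalGuarantee W₀ β t (M + 1) π ω) ≤
      W₀ * Real.exp (timeIntegral r 0 (t M) ω + noiseE p B₁ B₂ 0 (t M) ω) *
        Real.exp (-α * t M) * Real.exp (-α * Δ) * Real.exp (l * r (t M) ω) *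
          Real.exp (Y ω + E ω) + W₀ := by
    refine max_le ?_ ?_
    · have := mul_le_mul_of_nonneg_right hbound (Real.exp_pos (Y ω + E ω)).le
      linarith
    · have : 0 ≤ W₀ * Real.exp (timeIntegral r 0 (t M) ω + noiseE p B₁ B₂ 0 (t M) ω) *
        Real.exp (-α * t M) * Real.exp (-α * Δ) * Real.exp (l * r (t M) ω) *
          Real.exp (Y ω + E ω) := by positivity
      linarith [hcω.2]
  rw [Real.norm_of_nonneg (mul_nonneg ha0.le (mul_nonneg (Real.exp_pos _).le
    (le_max_of_le_right hcω.1)))]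
  refine (mul_le_mul_of_nonneg_left (mul_le_mul_of_nonneg_left hle (Real.exp_pos _).le)
    ha0.le).trans ?_
  have k1 := hexp ((1 - ℓ) * l * r (t M) ω + timeIntegral r 0 (t M) ω +
    noiseE p B₁ B₂ 0 (t M) ω) ((1 - ℓ) * Y ω + E ω)
  have k2 := hexp (-ℓ * l * r (t M) ω) (-ℓ * Y ω)
  have e1 : coeffA p ℓ t (M + 1) r ω * (Real.exp (-ℓ * Y ω) *
      (W₀ * Real.exp (timeIntegral r 0 (t M) ω + noiseE p B₁ B₂ 0 (t M) ω) *
        Real.exp (-α * t M) * Real.exp (-α * Δ) * Real.exp (l * r (t M) ω) *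
          Real.exp (Y ω + E ω) + W₀)) =
      W₀ * Real.exp (-α * t M) * Real.exp (-α * Δ) *
        Real.exp ((1 - ℓ) * l * r (t M) ω + timeIntegral r 0 (t M) ω +
          noiseE p B₁ B₂ 0 (t M) ω + ((1 - ℓ) * Y ω + E ω)) +
      W₀ * Real.exp (-ℓ * l * r (t M) ω + -ℓ * Y ω) := by
    have a1 : Real.exp ((1 - ℓ) * l * r (t M) ω + timeIntegral r 0 (t M) ω +
        noiseE p B₁ B₂ 0 (t M) ω + ((1 - ℓ) * Y ω + E ω)) =
        Real.exp (-ℓ * (l * r (t M) ω)) * (Real.exp (-ℓ * Y ω) *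
          (Real.exp (timeIntegral r 0 (t M) ω + noiseE p B₁ B₂ 0 (t M) ω) *
            (Real.exp (l * r (t M) ω) * Real.exp (Y ω + E ω)))) := by
      simp only [← Real.exp_add]
      congr 1
      ring
    have a2 : Real.exp (-ℓ * l * r (t M) ω + -ℓ * Y ω) =
        Real.exp (-ℓ * (l * r (t M) ω)) * Real.exp (-ℓ * Y ω) := by
      rw [← Real.exp_add]
      congr 1
      ring
    rw [a1, a2, coeffA]
    simp only [Nat.add_sub_cancel]
    rw [← hΔ, ← hl]
    ring
  rw [e1]
  have k1' := mul_le_mul_of_nonneg_left k1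
    (by positivity : 0 ≤ W₀ * Real.exp (-α * t M) * Real.exp (-α * Δ))
  have k2' := mul_le_mul_of_nonneg_left k2 hW₀
  refine (add_le_add k1' k2').trans_eq ?_
  simp only [Pi.add_apply]
  congr 4 <;> ring

end LastPeriod

end

theorem mainTheorem3 {Ω : Type*} {mΩ : MeasurableSpace Ω} (μ : Measure Ω) [IsProbabilityMeasure μ]
    (𝓕 : Filtration ℝ≥0 mΩ) (p : MarketParams)
    (hκ : p.κ ≠ 0) (hσr : 0 < p.σr) (hσS : 0 < p.σS) (hρ : p.ρ ∈ Set.Icc (-1 : ℝ) 1)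
    (r₀ S₀ : ℝ) (B₁ B₂ r S : ℝ≥0 → Ω → ℝ)
    (hmodel : IsMarketModel μ 𝓕 p r₀ S₀ B₁ B₂ r S)
    (N : ℕ) (hN : 1 ≤ N) (t : ℕ → ℝ≥0) (ht₀ : t 0 = 0) (ht : ∀ n < N, t n < t (n + 1))
    (W₀ : ℝ) (hW₀ : 0 ≤ W₀) (α β ℓ : ℝ) (hβ : β ∈ Set.Icc (0 : ℝ) 1)
    (π : ℕ → Ω → ℝ) (hπ : IsAdmissible μ 𝓕 W₀ t N π) :
    Integrable (discountedPayoff W₀ α β ℓ t N r S π) μ ∧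
    ∀ᵐ ω ∂μ,
      let Δ : ℝ := (t N : ℝ) - t (N - 1)
      let a : ℝ := coeffA p ℓ t N r ω
      let b : ℝ := coeffB p W₀ α t N r S π ω
      let c : ℝ := finalGuarantee W₀ β t N π ω
      let Y : Ω → ℝ := noiseY p r (t (N - 1)) (t N)
      let E : Ω → ℝ := noiseE p B₁ B₂ (t (N - 1)) (t N)
      let V : ℝ := (μ[discountedPayoff W₀ α β ℓ t N r S π | 𝓕 (t (N - 1))]) ω
      0 < a ∧ 0 ≤ b ∧ 0 ≤ c ∧
      V = a * (∫ ω', Real.exp (-ℓ * Y ω') * max (b * Real.exp (Y ω' + E ω')) c ∂μ) ∧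
      (b = 0 → V = valueB0 p ℓ Δ a c) ∧
      (c = 0 → V = valueC0 p ℓ Δ a b) ∧
      (0 < b → 0 < c →
        V = a * (∫ ω', Real.exp (max (Real.log b + (1 - ℓ) * Y ω' + E ω')
          (Real.log c - ℓ * Y ω')) ∂μ) ∧
        V = valuePos p ℓ Δ a b c) := by
  obtain ⟨M, rfl⟩ : ∃ M, N = M + 1 := ⟨N - 1, by lia⟩
  have hst : t M < t (M + 1) := ht M (Nat.lt_succ_self M)
  have hmono : ∀ k ≤ M, t k ≤ t M := by
    intro k hk
    have hle : ∀ d, k + d ≤ M → t k ≤ t (k + d) := by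
      intro d
      induction d with
      | zero => exact fun _ => le_rfl
      | succ d ih => exact fun hd => (ih (by lia)).trans (ht (k + d) (by lia)).le
    simpa [Nat.add_sub_cancel' hk] using hle (M - k) (by lia)
  have hY := hmodel.aemeasurable_noiseY hκ hst.le
  have hE := hmodel.measurable_noiseE (t M) (t (M + 1))
  -- the state at the start of the last period is known at that time
  have ha : Measurable[𝓕 (t M)] (coeffA p ℓ t (M + 1) r) :=
    Real.measurable_exp.comp (((hmodel.adapted_r (t M)).const_mul _).const_mul _)
  have hb : Measurable[𝓕 (t M)] (coeffB p W₀ α t (M + 1) r S π) :=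
    ((((hπ.measurable_wealthAccount hmodel.adapted_S (Nat.le_succ M) hmono).sub
      (hπ M (Nat.lt_succ_self M)).1).max measurable_const).mul_const _).mul
      (Real.measurable_exp.comp ((hmodel.adapted_r (t M)).const_mul _))
  have hc : Measurable[𝓕 (t M)] (finalGuarantee W₀ β t (M + 1) π) :=
    (measurable_cashflow _ _).comp
      (hπ.measurable_guaranteeAccount le_rfl fun k hk => hmono k (Nat.lt_succ_iff.1 hk))
  have hae := hmodel.discountedPayoff_ae_eq (W₀ := W₀) (α := α) (β := β) (ℓ := ℓ) (π := π)
    hκ hρ hst.le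
  have hint := hmodel.integrable_payoff (ℓ := ℓ) (α := α) hκ hρ ht₀ hst.le hW₀ hβ hπ
    (ha.mono (𝓕.le _) le_rfl) (hb.mono (𝓕.le _) le_rfl) (hc.mono (𝓕.le _) le_rfl)
  refine ⟨hint.congr hae.symm, ?_⟩
  have hf : @Measurable _ _ (@Prod.instMeasurableSpace Ω (ℝ × ℝ) (𝓕 (t M)) _) _
      fun z : Ω × (ℝ × ℝ) => coeffA p ℓ t (M + 1) r z.1 * (Real.exp (-ℓ * z.2.1) *
        max (coeffB p W₀ α t (M + 1) r S π z.1 * Real.exp (z.2.1 + z.2.2))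
          (finalGuarantee W₀ β t (M + 1) π z.1)) := by
    have h1 := @measurable_fst Ω (ℝ × ℝ) (𝓕 (t M)) inferInstance
    have h2 := @measurable_snd Ω (ℝ × ℝ) (𝓕 (t M)) inferInstance
    exact (ha.comp h1).mul ((Real.measurable_exp.comp ((measurable_fst.comp h2).const_mul _)).mul
      (((hb.comp h1).mul (Real.measurable_exp.comp ((measurable_fst.comp h2).add
        (measurable_snd.comp h2)))).max (hc.comp h1)))
  have hcond := (condExp_congr_ae (m := 𝓕 (t M)) hae).trans
    (condExp_eq_integral_of_indepFun_id (𝓕.le (t M)) (hY.prodMk hE.aemeasurable)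
      (hmodel.indepFun_noise hκ hst.le) hf hint)
  filter_upwards [hcond, hπ.finalGuarantee_bounds hW₀ hβ hst.le] with ω hV hcω
  simp only [Nat.add_sub_cancel]
  have hb0 := coeffB_nonneg (p := p) (W₀ := W₀) (α := α) (t := t) (M := M) (r := r) (S := S)
    (π := π) ω
  rw [integral_const_mul] at hV
  refine ⟨Real.exp_pos _, hb0, hcω.1, hV, fun hb => ?_, fun hc => ?_, fun hb hc => ?_⟩
  · rw [hV, hb, hmodel.integral_payoff_of_b_eq_zero hκ hρ hst.le ℓ hcω.1, valueB0, mul_assoc]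
  · rw [hV, hc, hmodel.integral_payoff_of_c_eq_zero hκ hσr hσS hρ hst ℓ hb0, valueC0,
      mul_assoc (coeffA p ℓ t (M + 1) r ω)]
  · simp only [exp_mul_max_eq_exp_max hb hc] at hV
    exact ⟨hV, hV.trans (hmodel.integral_payoff_of_pos hκ hσr hσS hρ hst ℓ _ _ _)⟩
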